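/- All Lie algebras are real and finite-dimensional. For a Lie algebra $\mathfrak h$, let $d$ be the Chevalley–Eilenberg differential on $\Lambda^*\mathfrak h^*$, determined by $d\alpha(X,Y)=-\alpha([X,Y])$ for $\alpha\in\mathfrak h^*$. Let $V$ be an oriented six-dimensional real vector space and $\nu\in\Lambda^6V^*$ a positive volume form. For $\rho\in\Lambda^3V^*$ let $K_\rho\in\operatorname{End}(V)$ be defined by $K_\rho(v)\lrcorner\nu=(v\lrcorner\rho)\wedge\rho$, and put $\lambda(\rho)=\tfrac16\operatorname{tr}K_\rho^2$, $\phi(\rho)=\sqrt{|\lambda(\rho)|}\,\nu$ and, if $\lambda(\rho)\ne0$, $J_\rho=|\lambda(\rho)|^{-1/2}K_\rho$ (the sign of $\lambda(\rho)$, the form $\phi(\rho)$ and $J_\rho$ do not depend on the choice of the positive form $\nu$). For $\omega\in\Lambda^2V^*$ put $\phi(\omega)=\tfrac16\omega^3$. A half-flat $\mathrm{SU}(3)$-structure on a six-dimensional Lie algebra $\mathfrak h$ is a pair $(\omega,\rho)\in\Lambda^2\mathfrak h^*\times\Lambda^3\mathfrak h^*$ such that, for some orientation of $\mathfrak h$,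 one has $\phi(\omega)\neq0$, $\lambda(\rho)<0$, $\omega\wedge\rho=0$, $\phi(\rho)=2\phi(\omega)$, the bilinear form $\omega(J_\rho\,\cdot\,,\cdot)$ is positive definite, and $d\rho=0$, $d(\omega^2)=0$. Describe a Lie algebra by $(de^1,\dots,de^n)$ for a basis $e^1,\dots,e^n$ of its dual, and write $e^{ij}=e^i\wedge e^j$. Let $\mathbb R^2$ be the abelian two-dimensional Lie algebra and let $$\mathfrak r_2=(0,e^{12}),\qquad A_{4,5}^{\alpha,\beta}=(e^{14},\alpha e^{24},\beta e^{34},0),$$ $$A_{4,9}^{\alpha}=((\alpha+1)e^{14}+e^{23},\,e^{24},\,\alpha e^{34},\,0),\qquad A_{4,12}=(e^{13}+e^{24},\,e^{41}+e^{23},\,0,\,0).$$ A non-zero Lie algebra is indecomposable if it is not a direct sum of two non-zero ideals, and unimodular if $\operatorname{tr}(\operatorname{ad}_X)=0$ for all $X$. **Proposition.** Let $\mathfrak g$ be an indecomposable four-dimensional Lie algebra. (i) The direct sum $\mathfrak g\oplus\mathbb R^2$ does not admit a half-flat $\mathrm{SU}(3)$-structure. (ii) If $\mathfrak g$ is not unimodular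 and is isomorphic neither to $A_{4,9}^{-1/2}$ nor to $A_{4,12}$, then $\mathfrak g\oplus\mathfrak r_2$ does not admit a half-flat $\mathrm{SU}(3)$-structure. (iii) The direct sum $A_{4,5}^{-1/2,-1/2}\oplus\mathfrak r_2$ does not admit a half-flat $\mathrm{SU}(3)$-structure. -/

import Mathlib

noncomputable section

namespace HalfFlat

/-! ### Exterior forms on a real vector space -/

section Forms

/-- Alternating `k`-forms on `V`, that is, the elements of `Λᵏ V*`. -/
abbrev Form (V : Type*) [AddCommGroup V] [Module ℝ V] (k : ℕ) : Type _ :=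
  V [⋀^Fin k]→ₗ[ℝ] ℝ

variable {V : Type*} [AddCommGroup V] [Module ℝ V]

/-- The wedge product of forms (the sum over all shuffles, so that
`(α ∧ β)(v, w) = α(v) β(w) - α(w) β(v)` for one-forms). -/
def wedge {p q : ℕ} (a : Form V p) (b : Form V q) : Form V (p + q) :=
  ((LinearMap.mul' ℝ ℝ).compAlternatingMap (a.domCoprod b)).domDomCongr finSumFinEquiv

/-- The interior product `v ⌟ a = a(v, ·, …, ·)`. -/
def interior {k : ℕ} (v : V) (a : Form V (k + 1)) : Form V k :=
  a.curryLeft v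

theorem wedge_add_left {p q : ℕ} (a a' : Form V p) (b : Form V q) :
    wedge (a + a') b = wedge a b + wedge a' b := by
  have h : (a + a').domCoprod b = a.domCoprod b + a'.domCoprod b := by
    have := (AlternatingMap.domCoprod' (R' := ℝ) (ιa := Fin p) (ιb := Fin q) (Mᵢ := V)
      (N₁ := ℝ) (N₂ := ℝ)).map_add (TensorProduct.tmul ℝ a b) (TensorProduct.tmul ℝ a' b)
    rwa [← TensorProduct.add_tmul] at this
  ext v
  simp [wedge, h, -AlternatingMap.domCoprod_apply]

theorem wedge_smul_left {p q : ℕ} (c : ℝ) (a : Form V p) (b : Form V q) :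
    wedge (c • a) b = c • wedge a b := by
  have h : (c • a).domCoprod b = c • a.domCoprod b := by
    have := (AlternatingMap.domCoprod' (R' := ℝ) (ιa := Fin p) (ιb := Fin q) (Mᵢ := V)
      (N₁ := ℝ) (N₂ := ℝ)).map_smul c (TensorProduct.tmul ℝ a b)
    rwa [TensorProduct.smul_tmul'] at this
  ext v
  simp [wedge, h, -AlternatingMap.domCoprod_apply]

/-- On a six-dimensional space a non-zero six-form `ν` gives an isomorphism `X ↦ X ⌟ ν`
from `V` to `Λ⁵ V*`. -/
theorem contraction_bijective (hV : Module.finrank ℝ V = 6) (ν : Form V 6) (hν : ν ≠ 0) :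
    Function.Bijective (AlternatingMap.curryLeft ν : V →ₗ[ℝ] Form V 5) := by
  have hfin : FiniteDimensional ℝ V := Module.finite_of_finrank_pos (by omega)
  let b : Module.Basis (Fin 6) ℝ V := Module.finBasisOfFinrankEq ℝ V hV
  have hinj : Function.Injective (AlternatingMap.curryLeft ν : V →ₗ[ℝ] Form V 5) := by
    rw [injective_iff_map_eq_zero]
    intro x hx
    by_contra hx0
    have hb : ν b ≠ 0 := fun h => hν ((AlternatingMap.map_basis_eq_zero_iff b ν).1 h)
    obtain ⟨i, hi⟩ : ∃ i, b.repr x i ≠ 0 := by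
      by_contra! h
      exact hx0 (b.repr.map_eq_zero_iff.1 (Finsupp.ext h))
    have h1 : ν (Function.update b i x) = b.repr x i * ν b := by
      conv_lhs => rw [← b.sum_repr x]
      rw [AlternatingMap.map_update_sum]
      rw [Finset.sum_eq_single i]
      · rw [AlternatingMap.map_update_smul, Function.update_eq_self, smul_eq_mul]
      · intro j _ hj
        rw [AlternatingMap.map_update_smul, AlternatingMap.map_update_self _ _ hj.symm, smul_zero]
      · simp
    have h0 : ∀ w : Fin 6 → V, w 0 = x → ν w = 0 := by
      intro w hw
      have := congrArg (fun f : Form V 5 => f (Fin.tail w)) hx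
      simp only [AlternatingMap.curryLeft_apply_apply, AlternatingMap.zero_apply] at this
      rw [← this, ← hw]
      exact congrArg ν (Fin.cons_self_tail w).symm
    have h2 : ν (Function.update b i x) = 0 := by
      have h3 := AlternatingMap.map_perm ν (Function.update b i x) (Equiv.swap 0 i)
      rw [h0 (Function.update b i x ∘ Equiv.swap 0 i) (by simp)] at h3
      exact (smul_eq_zero_iff_eq _).1 h3.symm
    rw [h1] at h2
    exact (mul_ne_zero hi hb) h2
  let T : Form V 5 →ₗ[ℝ] (Fin 6 → ℝ) :=
    { toFun := fun η i => η (fun j => b (i.succAbove j))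
      map_add' := fun _ _ => rfl
      map_smul' := fun _ _ => rfl }
  have hT : Function.Injective T := by
    rw [injective_iff_map_eq_zero]
    intro η hη
    refine Module.Basis.ext_alternating b fun v hv => ?_
    obtain ⟨i, hi⟩ : ∃ i, i ∉ Set.range v := by
      by_contra! h
      have := Fintype.card_le_of_surjective v h
      simp at this
    have h1 : ∀ j, ∃ k, i.succAbove k = v j := fun j =>
      Fin.exists_succAbove_eq fun h => hi ⟨j, h⟩
    choose σ hσ using h1
    have hσi : Function.Injective σ := fun j k h => hv (by rw [← hσ j, ← hσ k, h])
    have h2 := AlternatingMap.map_perm η (fun j => b (i.succAbove j))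
      (Equiv.ofBijective σ (Finite.injective_iff_bijective.1 hσi))
    have h3 : η (fun j => b (i.succAbove j)) = 0 := congrFun hη i
    rw [h3, smul_zero] at h2
    rw [AlternatingMap.zero_apply, ← h2]
    congr 1
    ext j
    simp [hσ]
  have hF : FiniteDimensional ℝ (Form V 5) := Module.Finite.of_injective T hT
  have hle : Module.finrank ℝ (Form V 5) ≤ 6 := by
    simpa using LinearMap.finrank_le_finrank_of_injective hT
  have hge : Module.finrank ℝ V ≤ Module.finrank ℝ (Form V 5) :=
    LinearMap.finrank_le_finrank_of_injective hinj
  have heq : Module.finrank ℝ V = Module.finrank ℝ (Form V 5) := by omega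
  exact ⟨hinj, (LinearMap.injective_iff_surjective_of_finrank_eq_finrank heq).1 hinj⟩

/-! ### Stable forms in dimension six

A non-zero six-form `ν` is used to trivialize the line `Λ⁶ V*` and to fix the orientation of `V`;
thus `K_ρ ∈ End(V) ⊗ Λ⁶ V*` becomes `hitchinK ρ ⊗ ν`, and `λ(ρ) ∈ (Λ⁶ V*)^{⊗ 2}` becomes
`hitchinLambda ρ` times `ν ⊗ ν`. -/

/-- The isomorphism `X ↦ X ⌟ ν` from `V` to `Λ⁵ V*`, the inverse of `κ`. -/
def contraction (hV : Module.finrank ℝ V = 6) (ν : Form V 6) (hν : ν ≠ 0) :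
    V ≃ₗ[ℝ] Form V 5 :=
  LinearEquiv.ofBijective _ (contraction_bijective hV ν hν)

/-- The endomorphism `K_ρ` relative to `ν`: `K_ρ(v) ⌟ ν = (v ⌟ ρ) ∧ ρ`. -/
def hitchinK (hV : Module.finrank ℝ V = 6) (ν : Form V 6) (hν : ν ≠ 0) (ρ : Form V 3) :
    V →ₗ[ℝ] V where
  toFun v := (contraction hV ν hν).symm (wedge (interior v ρ) ρ)
  map_add' v w := by
    rw [← map_add, ← wedge_add_left]
    simp [interior]
  map_smul' c v := by
    rw [RingHom.id_apply, ← map_smul, ← wedge_smul_left]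
    simp [interior]

theorem interior_hitchinK (hV : Module.finrank ℝ V = 6) (ν : Form V 6) (hν : ν ≠ 0)
    (ρ : Form V 3) (v : V) :
    interior (hitchinK hV ν hν ρ v) ν = wedge (interior v ρ) ρ :=
  (contraction hV ν hν).apply_symm_apply (wedge (interior v ρ) ρ)

/-- The quartic invariant `λ(ρ) = (1/6) tr K_ρ²` relative to `ν`. -/
def hitchinLambda (hV : Module.finrank ℝ V = 6) (ν : Form V 6) (hν : ν ≠ 0)
    (ρ : Form V 3) : ℝ :=
  (1 / 6) * LinearMap.trace ℝ V (hitchinK hV ν hν ρ ∘ₗ hitchinK hV ν hν ρ)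

/-- The volume form `φ(ρ) = √|λ(ρ)|`, with the root that is positive for the orientation
given by `ν`. -/
def volThree (hV : Module.finrank ℝ V = 6) (ν : Form V 6) (hν : ν ≠ 0) (ρ : Form V 3) :
    Form V 6 :=
  √|hitchinLambda hV ν hν ρ| • ν

/-- The endomorphism `J_ρ = K_ρ / φ(ρ)`. -/
def hitchinJ (hV : Module.finrank ℝ V = 6) (ν : Form V 6) (hν : ν ≠ 0) (ρ : Form V 3) :
    V →ₗ[ℝ] V :=
  (√|hitchinLambda hV ν hν ρ|)⁻¹ • hitchinK hV ν hν ρ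

/-- The volume form `φ(ω) = ω³ / 6`. -/
def volTwo (ω : Form V 2) : Form V 6 :=
  (1 / 6 : ℝ) • wedge (wedge ω ω) ω

/-- `(ω, ρ)` is an `SU(3)`-structure on the six-dimensional space `V` with the orientation given
by `ν`: a compatible and normalized pair of stable forms with `λ(ρ) < 0` (so that `ρ` is stable)
whose induced metric `g = ω(J_ρ ·, ·)` is positive definite. (The symmetry of `g` is a consequence
of the compatibility.) -/
structure IsSU3Structure (hV : Module.finrank ℝ V = 6) (ν : Form V 6) (hν : ν ≠ 0)
    (ω : Form V 2) (ρ : Form V 3) : Prop where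
  stable_two : volTwo ω ≠ 0
  lambda_neg : hitchinLambda hV ν hν ρ < 0
  compatible : wedge ω ρ = 0
  normalized : volThree hV ν hν ρ = (2 : ℝ) • volTwo ω
  metric_pos : ∀ v : V, v ≠ 0 → 0 < ω ![hitchinJ hV ν hν ρ v, v]

end Forms

/-! ### Lie algebras -/

section LieAlgebras

variable {L : Type*} [LieRing L] [LieAlgebra ℝ L]

/-- The Chevalley-Eilenberg differential with trivial coefficients,
`dα(x₀, …, x_{k+1}) = ∑_{i < j} (-1)^{i+j} α([x_i, x_j], x₀, …, x̂_i, …, x̂_j, …, x_{k+1})`.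
On one-forms it is `dα(x, y) = -α([x, y])`. For `i < j` the family without the entries `i`, `j`
is obtained by omitting first the entry `j` and then the entry `i`. -/
def ceDifferential {k : ℕ} (a : Form L (k + 1)) (x : Fin (k + 2) → L) : ℝ :=
  ∑ j : Fin (k + 2), ∑ i : Fin (k + 1),
    if i.castSucc < j then
      (-1) ^ ((i : ℕ) + (j : ℕ)) *
        a (Fin.cons ⁅x i.castSucc, x j⁆ fun l : Fin k => x (j.succAbove (i.succAbove l)))
    else 0

/-- A form `α` on a Lie algebra is closed if `dα = 0`. -/
def IsClosedForm {k : ℕ} (a : Form L (k + 1)) : Prop :=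
  ∀ x : Fin (k + 2) → L, ceDifferential a x = 0

variable (L)

/-- The Lie algebra `L` is six-dimensional and admits a half-flat `SU(3)`-structure, for some
orientation (given by a non-zero six-form `ν`). -/
def AdmitsHalfFlatSU3 : Prop :=
  ∃ (hL : Module.finrank ℝ L = 6) (ν : Form L 6) (hν : ν ≠ 0) (ω : Form L 2) (ρ : Form L 3),
    IsSU3Structure hL ν hν ω ρ ∧ IsClosedForm ρ ∧ IsClosedForm (k := 3) (wedge (p := 2) (q := 2) ω ω)

/-- A non-zero Lie algebra is indecomposable if it is not the direct sum of two non-zero ideals. -/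
def IsIndecomposable : Prop :=
  Nontrivial L ∧ ∀ I J : LieIdeal ℝ L, IsCompl I J → I = ⊥ ∨ J = ⊥

/-- A Lie algebra is unimodular if `tr(ad x) = 0` for all `x`. -/
def IsUnimodular : Prop :=
  ∀ x : L, LinearMap.trace ℝ L (LieAlgebra.ad ℝ L x) = 0

end LieAlgebras

/-! ### The Lie algebras of the statement

Each is given on a coordinate space by the exterior derivatives of the dual basis
`e¹, e², …` (with the indices starting at `0` in the code), through
`eᵏ([x, y]) = -deᵏ(x, y)`. -/

section Examples

/-- A Lie bracket on the coordinate space `ℝⁿ`. -/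
structure CoordBracket (n : ℕ) where
  toFun : (Fin n → ℝ) → (Fin n → ℝ) → (Fin n → ℝ)
  add_left : ∀ x y z, toFun (x + y) z = toFun x z + toFun y z
  add_right : ∀ x y z, toFun x (y + z) = toFun x y + toFun x z
  smul_right : ∀ (t : ℝ) (x y), toFun x (t • y) = t • toFun x y
  self : ∀ x, toFun x x = 0
  leibniz : ∀ x y z, toFun x (toFun y z) = toFun (toFun x y) z + toFun y (toFun x z)

/-- The space `ℝⁿ` as a Lie algebra with the bracket `b`. -/
def CoordBracket.Carrier {n : ℕ} (_b : CoordBracket n) : Type := Fin n → ℝ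

instance {n : ℕ} (b : CoordBracket n) : AddCommGroup b.Carrier :=
  inferInstanceAs (AddCommGroup (Fin n → ℝ))

instance {n : ℕ} (b : CoordBracket n) : Module ℝ b.Carrier :=
  inferInstanceAs (Module ℝ (Fin n → ℝ))

instance {n : ℕ} (b : CoordBracket n) : LieRing b.Carrier where
  bracket := b.toFun
  add_lie := b.add_left
  lie_add := b.add_right
  lie_self := b.self
  leibniz_lie := b.leibniz

instance {n : ℕ} (b : CoordBracket n) : LieAlgebra ℝ b.Carrier where
  lie_smul := b.smul_right

/-- `(eⁱ ∧ eʲ)(x, y)`, written `e^{ij}` in the descriptions below. -/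
def coordWedge {n : ℕ} (i j : Fin n) (x y : Fin n → ℝ) : ℝ :=
  x i * y j - x j * y i

/-- The bracket of `ℝ²`. -/
def R2Bracket : CoordBracket 2 where
  toFun := fun _ _ => 0
  add_left := by simp
  add_right := by simp
  smul_right := by simp
  self := by simp
  leibniz := by simp

/-- The abelian Lie algebra `ℝ²`. -/
abbrev R2 : Type := R2Bracket.Carrier

/-- The bracket of `𝔯₂`. -/
def r2Bracket : CoordBracket 2 where
  toFun := fun x y => -![0, coordWedge 0 1 x y]
  add_left := by
    intro x y z
    ext i
    fin_cases i
    · simp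
    · simp [coordWedge]
      ring
  add_right := by
    intro x y z
    ext i
    fin_cases i
    · simp
    · simp [coordWedge]
      ring
  smul_right := by
    intro t x y
    ext i
    fin_cases i
    · simp
    · simp [coordWedge]
      ring
  self := by
    intro x
    ext i
    fin_cases i <;> simp [coordWedge, mul_comm]
  leibniz := by
    intro x y z
    ext i
    fin_cases i
    · simp
    · simp [coordWedge]
      ring

/-- The non-abelian two-dimensional Lie algebra `𝔯₂`: `(0, e¹²)`. -/
abbrev r2 : Type := r2Bracket.Carrier

/-- The bracket of `A_{4,5}^{α,β}`. -/
def A45Bracket (α β : ℝ) : CoordBracket 4 where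
  toFun := fun x y => -![coordWedge 0 3 x y, α * coordWedge 1 3 x y, β * coordWedge 2 3 x y, 0]
  add_left := by
    intro x y z
    ext i
    fin_cases i <;> simp [coordWedge] <;> ring
  add_right := by
    intro x y z
    ext i
    fin_cases i <;> simp [coordWedge] <;> ring
  smul_right := by
    intro t x y
    ext i
    fin_cases i <;> simp [coordWedge] <;> ring
  self := by
    intro x
    ext i
    fin_cases i <;> simp [coordWedge] <;> ring_nf <;> simp
  leibniz := by
    intro x y z
    ext i
    fin_cases i <;> simp [coordWedge] <;> ring

/-- The Lie algebra `A_{4,5}^{α,β}`: `(e¹⁴, α e²⁴, β e³⁴, 0)`. -/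
abbrev A45 (α β : ℝ) : Type := (A45Bracket α β).Carrier

/-- The bracket of `A_{4,9}^α`. -/
def A49Bracket (α : ℝ) : CoordBracket 4 where
  toFun := fun x y => -![(α + 1) * coordWedge 0 3 x y + coordWedge 1 2 x y,
    coordWedge 1 3 x y, α * coordWedge 2 3 x y, 0]
  add_left := by
    intro x y z
    ext i
    fin_cases i <;> simp [coordWedge] <;> ring
  add_right := by
    intro x y z
    ext i
    fin_cases i <;> simp [coordWedge] <;> ring
  smul_right := by
    intro t x y
    ext i
    fin_cases i <;> simp [coordWedge] <;> ring
  self := by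
    intro x
    ext i
    fin_cases i <;> simp [coordWedge] <;> ring_nf <;> simp
  leibniz := by
    intro x y z
    ext i
    fin_cases i <;> simp [coordWedge] <;> ring

/-- The Lie algebra `A_{4,9}^α`: `((α + 1) e¹⁴ + e²³, e²⁴, α e³⁴, 0)`. -/
abbrev A49 (α : ℝ) : Type := (A49Bracket α).Carrier

/-- The bracket of `A_{4,12}`. -/
def A412Bracket : CoordBracket 4 where
  toFun := fun x y => -![coordWedge 0 2 x y + coordWedge 1 3 x y,
    coordWedge 3 0 x y + coordWedge 1 2 x y, 0, 0]
  add_left := by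
    intro x y z
    ext i
    fin_cases i <;> simp [coordWedge] <;> ring
  add_right := by
    intro x y z
    ext i
    fin_cases i <;> simp [coordWedge] <;> ring
  smul_right := by
    intro t x y
    ext i
    fin_cases i <;> simp [coordWedge] <;> ring
  self := by
    intro x
    ext i
    fin_cases i <;> simp [coordWedge] <;> ring_nf <;> simp
  leibniz := by
    intro x y z
    ext i
    fin_cases i <;> simp [coordWedge] <;> ring

/-- The Lie algebra `A_{4,12}`: `(e¹³ + e²⁴, e⁴¹ + e²³, 0, 0)`. -/
abbrev A412 : Type := A412Bracket.Carrier

end Examples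

end HalfFlat

end

/-!
For an `SU(3)`-structure `(ω, ρ)` the dual metric gives `α ∧ K_ρ^* α ∧ ω² ≠ 0` for every one-form
`α ≠ 0`. This condition only involves `ρ` and `ω²`, which are both closed if the
structure is half-flat; so an `α` for which `α ∧ K_ρ^* α ∧ σ = 0` for all closed `ρ ∈ Λ³` and
`σ ∈ Λ⁴` is an obstruction (Conti). In coordinates, with `α` dual to the last vector of a basis, it
is `IsSU3Structure.contractedForm_ne_zero`: the vector `P` with `P ⌟ ω` proportional to `α` is
expressed through `ω²` by Pfaffians, and `ω(K_ρ P, P) > 0`.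

To apply it without the classification of four-dimensional Lie algebras, every four-dimensional `g`
is brought to a normal form (`exists_milnorFrame`). There is a closed one-form `α ≠ 0` with
unimodular kernel `n`: the trace of `ad` if `g` is not unimodular, and any closed one-form if it is,
where `g` is not perfect because the exact two-forms are isotropic for the wedge product. The bracket
of `n` is diagonal in a suitable basis, with `[e₁, e₂] = a₀ e₀` and so on, and the fourth vector acts
on `n` by a derivation `d`. For this `α`, the obstruction is a polynomial in few coefficients of `ρ`
and `ω²` (`ClosedCoords`): a determinant of three two-forms on `n`, closed up to `[n, n]`, plus terms
which vanish if `tr d ≠ 0`. According to the rank of `a`, its non-vanishing makes `g` decomposable,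
or forces `tr d = 0`, or identifies `g` with `A_{4,9}^{-1/2}` or `A_{4,12}`; decompositions come from
idempotents in the centroid (`IsIndecomposable.idempotent_eq`).

For `A_{4,5}^{-1/2,-1/2} ⊕ 𝔯₂` this does not suffice: there the metric on the plane spanned by two
closed one-forms is computed, and it cannot be both symmetric and definite
(`not_admitsHalfFlatSU3_of_brackets`).
-/

noncomputable section

namespace HalfFlat

open scoped TensorProduct
open Equiv

/-! ### Wedge products and exterior derivatives in coordinates -/

/-- The wedge product as a sum over any complete family of representatives of the shuffles: `s` has
as many members as there are shuffles, and their first blocks differ as sets. -/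
theorem wedge_eq_sum_shuffles {V : Type*} [AddCommGroup V] [Module ℝ V] {p q N : ℕ}
    (hN : (p + q).choose p = N) (s : Fin N → Perm (Fin (p + q)))
    (hs : ∀ i j, i ≠ j → ∃ k : Fin p, ∀ l : Fin p, s j (Fin.castAdd q l) ≠ s i (Fin.castAdd q k))
    (a : Form V p) (b : Form V q) (v : Fin (p + q) → V) :
    wedge a b v = ∑ i, ((Perm.sign (s i) : ℤ) : ℝ) *
      (a (v ∘ fun k => s i (Fin.castAdd q k)) * b (v ∘ fun k => s i (Fin.natAdd p k))) := by
  classical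
  let e : Fin p ⊕ Fin q ≃ Fin (p + q) := finSumFinEquiv
  let f : Fin N → Perm.ModSumCongr (Fin p) (Fin q) := fun i =>
    Quotient.mk'' ((e.trans (s i)).trans e.symm)
  have hinj : Function.Injective f := by
    intro i j hij
    by_contra hne
    obtain ⟨k, hk⟩ := hs j i (Ne.symm hne)
    obtain ⟨⟨sl, sr⟩, h⟩ := QuotientGroup.leftRel_apply.mp (Quotient.exact' hij)
    have h1 := Equiv.congr_fun (inv_mul_eq_iff_eq_mul.mp h.symm) (Sum.inl k)
    have h2 := congrArg e h1
    simp [e] at h2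
    exact hk _ h2.symm
  have hcard : Fintype.card (Fin N) = Fintype.card (Perm.ModSumCongr (Fin p) (Fin q)) := by
    have h1 := Subgroup.card_eq_card_quotient_mul_card_subgroup
      (Perm.sumCongrHom (Fin p) (Fin q)).range
    simp only [Nat.card_eq_fintype_card, Perm.sumCongrHom.card_range, Fintype.card_perm,
      Fintype.card_sum, Fintype.card_fin, Fintype.card_prod] at h1
    have h2 := Nat.choose_mul_factorial_mul_factorial (Nat.le_add_right p q)
    rw [Nat.add_sub_cancel_left, hN, mul_assoc, h1] at h2
    have h3 : 0 < p.factorial * q.factorial := by positivity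
    rw [Fintype.card_fin]
    exact Nat.eq_of_mul_eq_mul_right h3 h2
  have hbij := (Fintype.bijective_iff_injective_and_card f).2 ⟨hinj, hcard⟩
  have h := Fintype.sum_bijective f hbij
    (fun i => ((Perm.sign (s i) : ℤ) : ℝ) *
      (a (v ∘ fun k => s i (Fin.castAdd q k)) * b (v ∘ fun k => s i (Fin.natAdd p k))))
    (fun σ => LinearMap.mul' ℝ ℝ (AlternatingMap.domCoprod.summand a b σ (v ∘ e))) (by
      intro i
      have hsign : Perm.sign ((e.trans (s i)).trans e.symm) = Perm.sign (s i) := by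
        simp
      simp only [f]
      rw [AlternatingMap.domCoprod.summand_mk'', hsign]
      change _ = LinearMap.mul' ℝ ℝ (Perm.sign (s i) •
        ((a fun k => v (e (((e.trans (s i)).trans e.symm) (Sum.inl k)))) ⊗ₜ[ℝ]
          (b fun k => v (e (((e.trans (s i)).trans e.symm) (Sum.inr k))))))
      rw [Units.smul_def, map_zsmul]
      simp [e, Function.comp_def])
  rw [h]
  simp [wedge, e, map_sum]

theorem comp_vecCons {α β : Type*} {n : ℕ} (v : α → β) (i : α) (f : Fin n → α) :
    v ∘ Matrix.vecCons i f = Matrix.vecCons (v i) (v ∘ f) := by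
  ext j
  cases j using Fin.cases <;> rfl

/-- The 6 shuffles of type `(2, 2)`, in the lexicographic order of their first block. -/
def shuffleTwoTwo : Fin 6 → Perm (Fin (2 + 2)) :=
  ![⟨![0, 1, 2, 3], ![0, 1, 2, 3], by decide, by decide⟩,
    ⟨![0, 2, 1, 3], ![0, 2, 1, 3], by decide, by decide⟩,
    ⟨![0, 3, 1, 2], ![0, 2, 3, 1], by decide, by decide⟩,
    ⟨![1, 2, 0, 3], ![2, 0, 1, 3], by decide, by decide⟩,
    ⟨![1, 3, 0, 2], ![2, 0, 3, 1], by decide, by decide⟩,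
    ⟨![2, 3, 0, 1], ![2, 3, 0, 1], by decide, by decide⟩]

theorem wedge_two_two_apply {V : Type*} [AddCommGroup V] [Module ℝ V]
    (a : Form V 2) (b : Form V 2) (v : Fin (2 + 2) → V) :
    wedge a b v =
      a ![v 0, v 1] * b ![v 2, v 3] - a ![v 0, v 2] * b ![v 1, v 3]
      + a ![v 0, v 3] * b ![v 1, v 2] + a ![v 1, v 2] * b ![v 0, v 3]
      - a ![v 1, v 3] * b ![v 0, v 2] + a ![v 2, v 3] * b ![v 0, v 1] := by
  have hsg : ∀ i, Perm.sign (shuffleTwoTwo i) =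
      (![1, -1, 1, 1, -1, 1] : Fin 6 → ℤˣ) i := by
    decide
  have hl : ∀ i, (fun k => shuffleTwoTwo i (Fin.castAdd 2 k)) =
      ![![0, 1], ![0, 2], ![0, 3], ![1, 2], ![1, 3], ![2, 3]] i := by
    decide
  have hr : ∀ i, (fun k => shuffleTwoTwo i (Fin.natAdd 2 k)) =
      ![![2, 3], ![1, 3], ![1, 2], ![0, 3], ![0, 2], ![0, 1]] i := by
    decide
  have h0 : ∀ f : Fin 0 → Fin (2 + 2), v ∘ f = ![] := fun f => Subsingleton.elim _ _
  rw [wedge_eq_sum_shuffles (by decide) shuffleTwoTwo (by decide)]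
  simp only [hsg, hl, hr, Fin.sum_univ_succ]
  simp [comp_vecCons, h0]
  ring

/-- The 10 shuffles of type `(2, 3)`, in the lexicographic order of their first block. -/
def shuffleTwoThree : Fin 10 → Perm (Fin (2 + 3)) :=
  ![⟨![0, 1, 2, 3, 4], ![0, 1, 2, 3, 4], by decide, by decide⟩,
    ⟨![0, 2, 1, 3, 4], ![0, 2, 1, 3, 4], by decide, by decide⟩,
    ⟨![0, 3, 1, 2, 4], ![0, 2, 3, 1, 4], by decide, by decide⟩,
    ⟨![0, 4, 1, 2, 3], ![0, 2, 3, 4, 1], by decide, by decide⟩,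
    ⟨![1, 2, 0, 3, 4], ![2, 0, 1, 3, 4], by decide, by decide⟩,
    ⟨![1, 3, 0, 2, 4], ![2, 0, 3, 1, 4], by decide, by decide⟩,
    ⟨![1, 4, 0, 2, 3], ![2, 0, 3, 4, 1], by decide, by decide⟩,
    ⟨![2, 3, 0, 1, 4], ![2, 3, 0, 1, 4], by decide, by decide⟩,
    ⟨![2, 4, 0, 1, 3], ![2, 3, 0, 4, 1], by decide, by decide⟩,
    ⟨![3, 4, 0, 1, 2], ![2, 3, 4, 0, 1], by decide, by decide⟩]

theorem wedge_two_three_apply {V : Type*} [AddCommGroup V] [Module ℝ V]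
    (a : Form V 2) (b : Form V 3) (v : Fin (2 + 3) → V) :
    wedge a b v =
      a ![v 0, v 1] * b ![v 2, v 3, v 4] - a ![v 0, v 2] * b ![v 1, v 3, v 4]
      + a ![v 0, v 3] * b ![v 1, v 2, v 4] - a ![v 0, v 4] * b ![v 1, v 2, v 3]
      + a ![v 1, v 2] * b ![v 0, v 3, v 4] - a ![v 1, v 3] * b ![v 0, v 2, v 4]
      + a ![v 1, v 4] * b ![v 0, v 2, v 3] + a ![v 2, v 3] * b ![v 0, v 1, v 4]
      - a ![v 2, v 4] * b ![v 0, v 1, v 3] + a ![v 3, v 4] * b ![v 0, v 1, v 2] := by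
  have hsg : ∀ i, Perm.sign (shuffleTwoThree i) =
      (![1, -1, 1, -1, 1, -1, 1, 1, -1, 1] : Fin 10 → ℤˣ) i := by
    decide
  have hl : ∀ i, (fun k => shuffleTwoThree i (Fin.castAdd 3 k)) =
      ![![0, 1], ![0, 2], ![0, 3], ![0, 4], ![1, 2], ![1, 3], ![1, 4], ![2, 3], ![2, 4],
      ![3, 4]] i := by
    decide
  have hr : ∀ i, (fun k => shuffleTwoThree i (Fin.natAdd 2 k)) =
      ![![2, 3, 4], ![1, 3, 4], ![1, 2, 4], ![1, 2, 3], ![0, 3, 4], ![0, 2, 4], ![0, 2, 3],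
      ![0, 1, 4], ![0, 1, 3], ![0, 1, 2]] i := by
    decide
  have h0 : ∀ f : Fin 0 → Fin (2 + 3), v ∘ f = ![] := fun f => Subsingleton.elim _ _
  rw [wedge_eq_sum_shuffles (by decide) shuffleTwoThree (by decide)]
  simp only [hsg, hl, hr, Fin.sum_univ_succ]
  simp [comp_vecCons, h0]
  ring

/-- The 15 shuffles of type `(4, 2)`, in the lexicographic order of their first block. -/
def shuffleFourTwo : Fin 15 → Perm (Fin (4 + 2)) :=
  ![⟨![0, 1, 2, 3, 4, 5], ![0, 1, 2, 3, 4, 5], by decide, by decide⟩,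
    ⟨![0, 1, 2, 4, 3, 5], ![0, 1, 2, 4, 3, 5], by decide, by decide⟩,
    ⟨![0, 1, 2, 5, 3, 4], ![0, 1, 2, 4, 5, 3], by decide, by decide⟩,
    ⟨![0, 1, 3, 4, 2, 5], ![0, 1, 4, 2, 3, 5], by decide, by decide⟩,
    ⟨![0, 1, 3, 5, 2, 4], ![0, 1, 4, 2, 5, 3], by decide, by decide⟩,
    ⟨![0, 1, 4, 5, 2, 3], ![0, 1, 4, 5, 2, 3], by decide, by decide⟩,
    ⟨![0, 2, 3, 4, 1, 5], ![0, 4, 1, 2, 3, 5], by decide, by decide⟩,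
    ⟨![0, 2, 3, 5, 1, 4], ![0, 4, 1, 2, 5, 3], by decide, by decide⟩,
    ⟨![0, 2, 4, 5, 1, 3], ![0, 4, 1, 5, 2, 3], by decide, by decide⟩,
    ⟨![0, 3, 4, 5, 1, 2], ![0, 4, 5, 1, 2, 3], by decide, by decide⟩,
    ⟨![1, 2, 3, 4, 0, 5], ![4, 0, 1, 2, 3, 5], by decide, by decide⟩,
    ⟨![1, 2, 3, 5, 0, 4], ![4, 0, 1, 2, 5, 3], by decide, by decide⟩,
    ⟨![1, 2, 4, 5, 0, 3], ![4, 0, 1, 5, 2, 3], by decide, by decide⟩,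
    ⟨![1, 3, 4, 5, 0, 2], ![4, 0, 5, 1, 2, 3], by decide, by decide⟩,
    ⟨![2, 3, 4, 5, 0, 1], ![4, 5, 0, 1, 2, 3], by decide, by decide⟩]

theorem wedge_four_two_apply {V : Type*} [AddCommGroup V] [Module ℝ V]
    (a : Form V 4) (b : Form V 2) (v : Fin (4 + 2) → V) :
    wedge a b v =
      a ![v 0, v 1, v 2, v 3] * b ![v 4, v 5] - a ![v 0, v 1, v 2, v 4] * b ![v 3, v 5]
      + a ![v 0, v 1, v 2, v 5] * b ![v 3, v 4] + a ![v 0, v 1, v 3, v 4] * b ![v 2, v 5]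
      - a ![v 0, v 1, v 3, v 5] * b ![v 2, v 4] + a ![v 0, v 1, v 4, v 5] * b ![v 2, v 3]
      - a ![v 0, v 2, v 3, v 4] * b ![v 1, v 5] + a ![v 0, v 2, v 3, v 5] * b ![v 1, v 4]
      - a ![v 0, v 2, v 4, v 5] * b ![v 1, v 3] + a ![v 0, v 3, v 4, v 5] * b ![v 1, v 2]
      + a ![v 1, v 2, v 3, v 4] * b ![v 0, v 5] - a ![v 1, v 2, v 3, v 5] * b ![v 0, v 4]
      + a ![v 1, v 2, v 4, v 5] * b ![v 0, v 3] - a ![v 1, v 3, v 4, v 5] * b ![v 0, v 2]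
      + a ![v 2, v 3, v 4, v 5] * b ![v 0, v 1] := by
  have hsg : ∀ i, Perm.sign (shuffleFourTwo i) =
      (![1, -1, 1, 1, -1, 1, -1, 1, -1, 1, 1, -1, 1, -1, 1] : Fin 15 → ℤˣ) i := by
    decide
  have hl : ∀ i, (fun k => shuffleFourTwo i (Fin.castAdd 2 k)) =
      ![![0, 1, 2, 3], ![0, 1, 2, 4], ![0, 1, 2, 5], ![0, 1, 3, 4], ![0, 1, 3, 5],
      ![0, 1, 4, 5], ![0, 2, 3, 4], ![0, 2, 3, 5], ![0, 2, 4, 5], ![0, 3, 4, 5], ![1, 2, 3, 4],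
      ![1, 2, 3, 5], ![1, 2, 4, 5], ![1, 3, 4, 5], ![2, 3, 4, 5]] i := by
    decide
  have hr : ∀ i, (fun k => shuffleFourTwo i (Fin.natAdd 4 k)) =
      ![![4, 5], ![3, 5], ![3, 4], ![2, 5], ![2, 4], ![2, 3], ![1, 5], ![1, 4], ![1, 3],
      ![1, 2], ![0, 5], ![0, 4], ![0, 3], ![0, 2], ![0, 1]] i := by
    decide
  have h0 : ∀ f : Fin 0 → Fin (4 + 2), v ∘ f = ![] := fun f => Subsingleton.elim _ _
  rw [wedge_eq_sum_shuffles (by decide) shuffleFourTwo (by decide)]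
  simp only [hsg, hl, hr, Fin.sum_univ_succ]
  simp [comp_vecCons, h0]
  ring

section Evaluation

variable {V : Type*} [AddCommGroup V] [Module ℝ V]

/-- A two-form as a function of two vectors. -/
def ev2 (a : Form V 2) (x y : V) : ℝ := a ![x, y]

/-- A three-form as a function of three vectors. -/
def ev3 (a : Form V 3) (x y z : V) : ℝ := a ![x, y, z]

/-- A four-form as a function of four vectors. -/
def ev4 (a : Form V 4) (x y z w : V) : ℝ := a ![x, y, z, w]

theorem form_vecCons_zero {k : ℕ} (a : Form V (k + 1)) (v : Fin k → V) :
    a (Matrix.vecCons 0 v) = 0 :=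
  a.map_coord_zero 0 rfl

theorem ev2_swap (a : Form V 2) (x y : V) : ev2 a x y = -ev2 a y x := by
  have h := a.map_swap ![y, x] (i := 0) (j := 1) (by decide)
  have h' : ![y, x] ∘ Equiv.swap (0 : Fin 2) 1 = ![x, y] := by
    ext i; fin_cases i <;> rfl
  rw [h'] at h
  exact h

theorem ev3_swap (a : Form V 3) (x y z : V) : ev3 a x y z = -ev3 a y x z := by
  have h := a.map_swap ![y, x, z] (i := 0) (j := 1) (by decide)
  have h' : ![y, x, z] ∘ Equiv.swap (0 : Fin 3) 1 = ![x, y, z] := by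
    ext i; fin_cases i <;> rfl
  rw [h'] at h
  exact h

theorem ev3_swap' (a : Form V 3) (x y z : V) : ev3 a x y z = -ev3 a x z y := by
  have h := a.map_swap ![x, z, y] (i := 1) (j := 2) (by decide)
  have h' : ![x, z, y] ∘ Equiv.swap (1 : Fin 3) 2 = ![x, y, z] := by
    ext i; fin_cases i <;> rfl
  rw [h'] at h
  exact h

theorem ev4_swap (a : Form V 4) (x y z w : V) : ev4 a x y z w = -ev4 a y x z w := by
  have h := a.map_swap ![y, x, z, w] (i := 0) (j := 1) (by decide)
  have h' : ![y, x, z, w] ∘ Equiv.swap (0 : Fin 4) 1 = ![x, y, z, w] := by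
    ext i; fin_cases i <;> rfl
  rw [h'] at h
  exact h

theorem ev4_swap' (a : Form V 4) (x y z w : V) : ev4 a x y z w = -ev4 a x z y w := by
  have h := a.map_swap ![x, z, y, w] (i := 1) (j := 2) (by decide)
  have h' : ![x, z, y, w] ∘ Equiv.swap (1 : Fin 4) 2 = ![x, y, z, w] := by
    ext i; fin_cases i <;> rfl
  rw [h'] at h
  exact h

theorem ev4_swap'' (a : Form V 4) (x y z w : V) : ev4 a x y z w = -ev4 a x y w z := by
  have h := a.map_swap ![x, y, w, z] (i := 2) (j := 3) (by decide)
  have h' : ![x, y, w, z] ∘ Equiv.swap (2 : Fin 4) 3 = ![x, y, z, w] := by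
    ext i; fin_cases i <;> rfl
  rw [h'] at h
  exact h

theorem ev2_add_left (a : Form V 2) (x x' y : V) :
    ev2 a (x + x') y = ev2 a x y + ev2 a x' y :=
  a.map_vecCons_add _ _ _

theorem ev2_smul_left (a : Form V 2) (c : ℝ) (x y : V) :
    ev2 a (c • x) y = c * ev2 a x y :=
  a.map_vecCons_smul _ _ _

theorem ev3_add (a : Form V 3) (x x' y z : V) :
    ev3 a (x + x') y z = ev3 a x y z + ev3 a x' y z :=
  a.map_vecCons_add _ _ _

theorem ev3_smul (a : Form V 3) (c : ℝ) (x y z : V) :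
    ev3 a (c • x) y z = c * ev3 a x y z :=
  a.map_vecCons_smul _ _ _

theorem ev3_neg (a : Form V 3) (x y z : V) : ev3 a (-x) y z = -ev3 a x y z := by
  rw [← neg_one_smul ℝ x, ev3_smul, neg_one_mul]

theorem ev3_zero (a : Form V 3) (y z : V) : ev3 a 0 y z = 0 :=
  form_vecCons_zero a _

theorem ev4_add (a : Form V 4) (x x' y z w : V) :
    ev4 a (x + x') y z w = ev4 a x y z w + ev4 a x' y z w :=
  a.map_vecCons_add _ _ _

theorem ev4_smul (a : Form V 4) (c : ℝ) (x y z w : V) :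
    ev4 a (c • x) y z w = c * ev4 a x y z w :=
  a.map_vecCons_smul _ _ _

theorem ev4_neg (a : Form V 4) (x y z w : V) : ev4 a (-x) y z w = -ev4 a x y z w := by
  rw [← neg_one_smul ℝ x, ev4_smul, neg_one_mul]

theorem ev4_zero (a : Form V 4) (y z w : V) : ev4 a 0 y z w = 0 :=
  form_vecCons_zero a _

theorem ev4_wedge_self (ω : Form V 2) (x y z w : V) :
    ev4 (wedge (p := 2) (q := 2) ω ω) x y z w =
      2 * (ev2 ω x y * ev2 ω z w - ev2 ω x z * ev2 ω y w + ev2 ω x w * ev2 ω y z) := by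
  have h := wedge_two_two_apply ω ω ![x, y, z, w]
  simp only [Matrix.cons_val] at h
  simp only [ev4, ev2]
  refine h.trans ?_
  ring

/-- The contraction `(x ⌟ ρ) ∧ ρ` in coordinates. -/
theorem wedge_interior_apply (ρ : Form V 3) (x : V) (v : Fin 5 → V) :
    wedge (interior x ρ) ρ v =
      ev3 ρ x (v 0) (v 1) * ev3 ρ (v 2) (v 3) (v 4)
      - ev3 ρ x (v 0) (v 2) * ev3 ρ (v 1) (v 3) (v 4)
      + ev3 ρ x (v 0) (v 3) * ev3 ρ (v 1) (v 2) (v 4)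
      - ev3 ρ x (v 0) (v 4) * ev3 ρ (v 1) (v 2) (v 3)
      + ev3 ρ x (v 1) (v 2) * ev3 ρ (v 0) (v 3) (v 4)
      - ev3 ρ x (v 1) (v 3) * ev3 ρ (v 0) (v 2) (v 4)
      + ev3 ρ x (v 1) (v 4) * ev3 ρ (v 0) (v 2) (v 3)
      + ev3 ρ x (v 2) (v 3) * ev3 ρ (v 0) (v 1) (v 4)
      - ev3 ρ x (v 2) (v 4) * ev3 ρ (v 0) (v 1) (v 3)
      + ev3 ρ x (v 3) (v 4) * ev3 ρ (v 0) (v 1) (v 2) :=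
  wedge_two_three_apply (interior x ρ) ρ v

end Evaluation

section Closed

variable {L : Type*} [LieRing L] [LieAlgebra ℝ L]

/-- The equation `dρ = 0`, evaluated on four vectors. -/
theorem IsClosedForm.ev3 {ρ : Form L 3} (h : IsClosedForm ρ) (x y z w : L) :
    -ev3 ρ ⁅x, y⁆ z w + ev3 ρ ⁅x, z⁆ y w - ev3 ρ ⁅x, w⁆ y z - ev3 ρ ⁅y, z⁆ x w
      + ev3 ρ ⁅y, w⁆ x z - ev3 ρ ⁅z, w⁆ x y = 0 := by
  have key : ∀ (v : L) (f : Fin 2 → L), ρ (Fin.cons v f) = HalfFlat.ev3 ρ v (f 0) (f 1) := by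
    intro v f
    refine congrArg ρ ?_
    ext i
    fin_cases i <;> rfl
  have h1 := h ![x, y, z, w]
  simp only [ceDifferential, key] at h1
  simp [Fin.sum_univ_succ, Fin.succAbove] at h1
  linear_combination h1

/-- The equation `dσ = 0`, evaluated on five vectors. -/
theorem IsClosedForm.ev4 {σ : Form L 4} (h : IsClosedForm σ) (x y z w u : L) :
    -ev4 σ ⁅x, y⁆ z w u + ev4 σ ⁅x, z⁆ y w u - ev4 σ ⁅x, w⁆ y z u + ev4 σ ⁅x, u⁆ y z w
      - ev4 σ ⁅y, z⁆ x w u + ev4 σ ⁅y, w⁆ x z u - ev4 σ ⁅y, u⁆ x z w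
      - ev4 σ ⁅z, w⁆ x y u + ev4 σ ⁅z, u⁆ x y w - ev4 σ ⁅w, u⁆ x y z = 0 := by
  have key : ∀ (v : L) (f : Fin 3 → L),
      σ (Fin.cons v f) = HalfFlat.ev4 σ v (f 0) (f 1) (f 2) := by
    intro v f
    refine congrArg σ ?_
    ext i
    fin_cases i <;> rfl
  have h1 := h ![x, y, z, w, u]
  simp only [ceDifferential, key] at h1
  simp [Fin.sum_univ_succ, Fin.succAbove] at h1
  linear_combination h1

end Closed

/-! ### Inequalities satisfied by an `SU(3)`-structure -/

section Obstruction

variable {V : Type*} [AddCommGroup V] [Module ℝ V]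

/-- The vector `P` in the span of `u₀, …, u₄` with `P ⌟ ω = 0` on that span, whose coefficients
are (twice) the Pfaffians of the `4 × 4` principal minors of `(ω(uᵢ, uⱼ))`. It depends on `ω` only
through `ω²`. -/
def pfaffianVector (ω : Form V 2) (u : Fin 5 → V) : V :=
  ev4 (wedge (p := 2) (q := 2) ω ω) (u 1) (u 2) (u 3) (u 4) • u 0
    + (-ev4 (wedge (p := 2) (q := 2) ω ω) (u 0) (u 2) (u 3) (u 4)) • u 1
    + ev4 (wedge (p := 2) (q := 2) ω ω) (u 0) (u 1) (u 3) (u 4) • u 2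
    + (-ev4 (wedge (p := 2) (q := 2) ω ω) (u 0) (u 1) (u 2) (u 4)) • u 3
    + ev4 (wedge (p := 2) (q := 2) ω ω) (u 0) (u 1) (u 2) (u 3) • u 4

/-- The five-form `(P ⌟ ρ) ∧ ρ` on `u'`, where `P` is the Pfaffian vector of `u`. If `α` and `α'`
span the annihilators of `u` and `u'`, this is a multiple of `α ∧ K_ρ^* α' ∧ ω²`. -/
def contractedForm (ω : Form V 2) (ρ : Form V 3) (u u' : Fin 5 → V) : ℝ :=
  wedge (interior (pfaffianVector ω u) ρ) ρ u'

theorem contractedForm_apply {ω : Form V 2} {u : Fin 5 → V} {P : V} (hP : pfaffianVector ω u = P)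
    (ρ : Form V 3) (v : Fin 5 → V) :
    contractedForm ω ρ u v =
      ev3 ρ P (v 0) (v 1) * ev3 ρ (v 2) (v 3) (v 4)
      - ev3 ρ P (v 0) (v 2) * ev3 ρ (v 1) (v 3) (v 4)
      + ev3 ρ P (v 0) (v 3) * ev3 ρ (v 1) (v 2) (v 4)
      - ev3 ρ P (v 0) (v 4) * ev3 ρ (v 1) (v 2) (v 3)
      + ev3 ρ P (v 1) (v 2) * ev3 ρ (v 0) (v 3) (v 4)
      - ev3 ρ P (v 1) (v 3) * ev3 ρ (v 0) (v 2) (v 4)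
      + ev3 ρ P (v 1) (v 4) * ev3 ρ (v 0) (v 2) (v 3)
      + ev3 ρ P (v 2) (v 3) * ev3 ρ (v 0) (v 1) (v 4)
      - ev3 ρ P (v 2) (v 4) * ev3 ρ (v 0) (v 1) (v 3)
      + ev3 ρ P (v 3) (v 4) * ev3 ρ (v 0) (v 1) (v 2) := by
  subst hP
  exact wedge_interior_apply ρ _ v

theorem ev2_self (ω : Form V 2) (x : V) : ev2 ω x x = 0 := by
  linarith [ev2_swap ω x x]

/-- The vectors `b i` with `i ≠ j`, in order. -/
def skip (b : Fin 6 → V) (j : Fin 6) : Fin 5 → V := fun k => b (j.succAbove k)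

/-- A two-form as a bilinear form. -/
def bilinOfForm (ω : Form V 2) : LinearMap.BilinForm ℝ V :=
  LinearMap.mk₂ ℝ (ev2 ω) (ev2_add_left ω) (ev2_smul_left ω)
    (fun x y y' => by
      rw [ev2_swap, ev2_add_left, ev2_swap ω y, ev2_swap ω y']
      ring)
    (fun c x y => by
      rw [ev2_swap, ev2_smul_left, ev2_swap ω y]
      simp)

/-- The contraction `P ⌟ ω` of the Pfaffian vector `P` of `b 0, …, b 4` is a multiple of the
covector dual to `b 5`. -/
theorem ev2_pfaffianVector (ω : Form V 2) (b : Module.Basis (Fin 6) ℝ V) (y : V) :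
    ev2 ω (pfaffianVector ω (skip b 5)) y = 2 * volTwo ω b * b.repr y 5 := by
  have h : ∀ j, ev2 ω (pfaffianVector ω (skip b 5)) (b j) =
      2 * volTwo ω b * b.repr (b j) 5 := by
    have hvol : volTwo ω b = 1 / 6 * wedge (wedge (p := 2) (q := 2) ω ω) ω b := rfl
    intro j
    rw [hvol, wedge_four_two_apply]
    change _ = 2 * (1 / 6 *
      (ev4 _ (b 0) (b 1) (b 2) (b 3) * ev2 ω (b 4) (b 5)
        - ev4 _ (b 0) (b 1) (b 2) (b 4) * ev2 ω (b 3) (b 5)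
        + ev4 _ (b 0) (b 1) (b 2) (b 5) * ev2 ω (b 3) (b 4)
        + ev4 _ (b 0) (b 1) (b 3) (b 4) * ev2 ω (b 2) (b 5)
        - ev4 _ (b 0) (b 1) (b 3) (b 5) * ev2 ω (b 2) (b 4)
        + ev4 _ (b 0) (b 1) (b 4) (b 5) * ev2 ω (b 2) (b 3)
        - ev4 _ (b 0) (b 2) (b 3) (b 4) * ev2 ω (b 1) (b 5)
        + ev4 _ (b 0) (b 2) (b 3) (b 5) * ev2 ω (b 1) (b 4)
        - ev4 _ (b 0) (b 2) (b 4) (b 5) * ev2 ω (b 1) (b 3)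
        + ev4 _ (b 0) (b 3) (b 4) (b 5) * ev2 ω (b 1) (b 2)
        + ev4 _ (b 1) (b 2) (b 3) (b 4) * ev2 ω (b 0) (b 5)
        - ev4 _ (b 1) (b 2) (b 3) (b 5) * ev2 ω (b 0) (b 4)
        + ev4 _ (b 1) (b 2) (b 4) (b 5) * ev2 ω (b 0) (b 3)
        - ev4 _ (b 1) (b 3) (b 4) (b 5) * ev2 ω (b 0) (b 2)
        + ev4 _ (b 2) (b 3) (b 4) (b 5) * ev2 ω (b 0) (b 1))) * _
    have ho : ∀ k : Fin 5, skip b 5 k = b k.castSucc := fun k => by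
      fin_cases k <;> rfl
    simp only [pfaffianVector, ho, ev2_add_left, ev2_smul_left, ev4_wedge_self]
    have e (i k : Fin 6) (_ : k < i) : ev2 ω (b i) (b k) = -ev2 ω (b k) (b i) := ev2_swap _ _ _
    fin_cases j <;>
      simp [ev2_self, e, Module.Basis.repr_self] <;> ring
  have hl := b.ext (f₁ := bilinOfForm ω (pfaffianVector ω (skip b 5)))
    (f₂ := (2 * volTwo ω b) • b.coord 5) h
  exact LinearMap.congr_fun hl y

/-- The coordinates of `K_ρ v`, read off from `K_ρ v ⌟ ν = (v ⌟ ρ) ∧ ρ`. -/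
theorem hitchinK_repr (hV : Module.finrank ℝ V = 6) (ν : Form V 6) (hν : ν ≠ 0)
    (ρ : Form V 3) (b : Module.Basis (Fin 6) ℝ V) (v : V) (j : Fin 6) :
    b.repr (hitchinK hV ν hν ρ v) j * ν b =
      (-1) ^ (j : ℕ) * wedge (interior v ρ) ρ (skip b j) := by
  rw [← interior_hitchinK hV ν hν ρ v]
  set w := hitchinK hV ν hν ρ v
  have h1 : interior w ν (skip b j) = ν (Matrix.vecCons w (skip b j)) := rfl
  have h2 : ∀ i, ν (Matrix.vecCons (b i) (skip b j)) =
      if i = j then (-1) ^ (j : ℕ) * ν b else 0 := by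
    intro i
    split_ifs with h
    · subst h
      have h3 := ν.map_perm b (Fin.cycleRange i).symm
      have h4 : b ∘ (Fin.cycleRange i).symm = Matrix.vecCons (b i) (skip b i) := by
        ext k
        cases k using Fin.cases <;> simp [skip]
      rw [h4] at h3
      rw [h3]
      simp [Fin.sign_cycleRange, Units.smul_def]
    · obtain ⟨k, hk⟩ := Fin.exists_succAbove_eq h
      exact ν.map_eq_zero_of_eq _ (i := 0) (j := k.succ) (by simp [skip, hk])
        (Fin.succ_ne_zero k).symm
  have h5 : ν (Matrix.vecCons w (skip b j)) =
      ∑ i, b.repr w i * ν (Matrix.vecCons (b i) (skip b j)) := by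
    let φ : V →ₗ[ℝ] ℝ :=
      { toFun := fun x => ν (Matrix.vecCons x (skip b j))
        map_add' := fun x y => ν.map_vecCons_add _ x y
        map_smul' := fun c x => ν.map_vecCons_smul _ c x }
    have h6 := map_sum φ (fun i => b.repr w i • b i) Finset.univ
    rw [b.sum_repr] at h6
    simpa [φ, smul_eq_mul] using h6
  rw [h1, h5]
  simp only [h2, mul_ite, mul_zero, Finset.sum_ite_eq', Finset.mem_univ, if_true]
  have h8 : ((-1 : ℝ) ^ (j : ℕ)) * (-1) ^ (j : ℕ) = 1 := by rw [← mul_pow]; simp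
  linear_combination -(b.repr w j * ν b) * h8

variable {hV : Module.finrank ℝ V = 6} {ν : Form V 6} {hν : ν ≠ 0} {ω : Form V 2} {ρ : Form V 3}

theorem IsSU3Structure.volTwo_basis_ne_zero (h : IsSU3Structure hV ν hν ω ρ)
    (b : Module.Basis (Fin 6) ℝ V) : volTwo ω b ≠ 0 := by
  intro h0
  have h1 := (AlternatingMap.map_basis_eq_zero_iff b (volTwo ω : Form V 6)).1
  have h2 := h.stable_two
  generalize volTwo ω = q at h0 h1 h2
  exact h2 (h1 h0)

theorem IsSU3Structure.ev2_hitchinK_pos (h : IsSU3Structure hV ν hν ω ρ) {v : V} (hv : v ≠ 0) :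
    0 < ev2 ω (hitchinK hV ν hν ρ v) v := by
  have h1 : 0 < ev2 ω (hitchinJ hV ν hν ρ v) v := h.metric_pos v hv
  rw [hitchinJ, LinearMap.smul_apply, ev2_smul_left] at h1
  exact pos_of_mul_pos_right h1 (by positivity)

theorem pfaffianVector_ne_zero {b : Module.Basis (Fin 6) ℝ V} (h : volTwo ω b ≠ 0) :
    pfaffianVector ω (skip b 5) ≠ 0 := by
  intro h0
  have h1 := ev2_pfaffianVector ω b (b 5)
  rw [h0] at h1
  have h2 : ev2 ω 0 (b 5) = 0 := form_vecCons_zero ω _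
  rw [h2] at h1
  rw [b.repr_self, Finsupp.single_eq_same] at h1
  exact h (by linarith)

/-- The length of the covector dual to `b 5`, up to positive factors. -/
theorem IsSU3Structure.contractedForm_pos (h : IsSU3Structure hV ν hν ω ρ)
    (b : Module.Basis (Fin 6) ℝ V) :
    0 < volTwo ω b * ν b * contractedForm ω ρ (skip b 5) (skip b 5) := by
  set P := pfaffianVector ω (skip b 5) with hP
  have h1 := h.ev2_hitchinK_pos (pfaffianVector_ne_zero (h.volTwo_basis_ne_zero b))
  rw [ev2_swap, ev2_pfaffianVector] at h1
  have h2 := hitchinK_repr hV ν hν ρ b P 5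
  have h3 : contractedForm ω ρ (skip b 5) (skip b 5) =
      -(b.repr (hitchinK hV ν hν ρ P) 5 * ν b) := by
    rw [h2, contractedForm]
    norm_num
    ring
  have h4 : ν b ≠ 0 := fun h0 => hν ((AlternatingMap.map_basis_eq_zero_iff b ν).1 h0)
  rw [h3]
  have h5 : 0 < ν b * ν b := mul_self_pos.2 h4
  nlinarith [mul_pos h1 h5]

/-- Conti's obstruction: `α ∧ K_ρ^* α ∧ ω² ≠ 0` for every one-form `α ≠ 0`. -/
theorem IsSU3Structure.contractedForm_ne_zero (h : IsSU3Structure hV ν hν ω ρ)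
    (b : Module.Basis (Fin 6) ℝ V) : contractedForm ω ρ (skip b 5) (skip b 5) ≠ 0 :=
  right_ne_zero_of_mul (h.contractedForm_pos b).ne'

/-- The symmetry of the metric on a pair of basis vectors; it comes from `ω ∧ ρ = 0`. -/
theorem IsSU3Structure.symm_basis (h : IsSU3Structure hV ν hν ω ρ)
    (b : Module.Basis (Fin 6) ℝ V) :
    ev2 ω (hitchinK hV ν hν ρ (b 0)) (b 1) = ev2 ω (hitchinK hV ν hν ρ (b 1)) (b 0) := by
  have hν0 : ν b ≠ 0 := fun h0 => hν ((AlternatingMap.map_basis_eq_zero_iff b ν).1 h0)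
  have expand : ∀ v w, ev2 ω (hitchinK hV ν hν ρ v) w * ν b =
      ∑ j : Fin 6, (-1) ^ (j : ℕ) * wedge (interior v ρ) ρ (skip b j) * ev2 ω (b j) w := by
    intro v w
    simp only [← hitchinK_repr hV ν hν]
    have h1 := LinearMap.congr_fun (map_sum (bilinOfForm ω)
      (fun i => b.repr (hitchinK hV ν hν ρ v) i • b i) Finset.univ) w
    rw [b.sum_repr] at h1
    have h2 : ev2 ω (hitchinK hV ν hν ρ v) w =
      ∑ i, b.repr (hitchinK hV ν hν ρ v) i * ev2 ω (b i) w := by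
      refine h1.trans ?_
      simp [bilinOfForm]
    rw [h2, Finset.sum_mul]
    exact Finset.sum_congr rfl fun j _ => by ring
  have comp : ∀ u : Fin 5 → V, ev2 ω (u 0) (u 1) * ev3 ρ (u 2) (u 3) (u 4)
      - ev2 ω (u 0) (u 2) * ev3 ρ (u 1) (u 3) (u 4)
      + ev2 ω (u 0) (u 3) * ev3 ρ (u 1) (u 2) (u 4)
      - ev2 ω (u 0) (u 4) * ev3 ρ (u 1) (u 2) (u 3)
      + ev2 ω (u 1) (u 2) * ev3 ρ (u 0) (u 3) (u 4)
      - ev2 ω (u 1) (u 3) * ev3 ρ (u 0) (u 2) (u 4)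
      + ev2 ω (u 1) (u 4) * ev3 ρ (u 0) (u 2) (u 3)
      + ev2 ω (u 2) (u 3) * ev3 ρ (u 0) (u 1) (u 4)
      - ev2 ω (u 2) (u 4) * ev3 ρ (u 0) (u 1) (u 3)
      + ev2 ω (u 3) (u 4) * ev3 ρ (u 0) (u 1) (u 2) = 0 := by
    intro u
    have h1 := wedge_two_three_apply ω ρ u
    rw [h.compatible] at h1
    exact h1.symm
  -- The difference of the two sides is `(b 1 ⌟ b 0 ⌟ ρ) ∧ ω ∧ ρ` up to a factor.
  have c2 := comp (skip b 2)
  have c3 := comp (skip b 3)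
  have c4 := comp (skip b 4)
  have c5 := comp (skip b 5)
  have e2 (i k : Fin 6) (_ : k < i) : ev2 ω (b i) (b k) = -ev2 ω (b k) (b i) := ev2_swap _ _ _
  have e3 (i j k : Fin 6) (_ : j < i) : ev3 ρ (b i) (b j) (b k) = -ev3 ρ (b j) (b i) (b k) :=
    ev3_swap _ _ _ _
  have s2 (x : V) : ev2 ω x x = 0 := ev2_self ω x
  have s3 (x y : V) : ev3 ρ x x y = 0 := by linarith [ev3_swap ρ x x y]
  have s3' (x y : V) : ev3 ρ x y y = 0 := by linarith [ev3_swap' ρ x y y]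
  refine mul_right_cancel₀ hν0 ?_
  rw [expand, expand]
  simp only [wedge_interior_apply, skip, Fin.sum_univ_six] at *
  simp [Fin.succAbove, e2, e3, s2, s3, s3'] at c2 c3 c4 c5 ⊢
  linear_combination 2 * ev3 ρ (b 0) (b 1) (b 2) * c2 - 2 * ev3 ρ (b 0) (b 1) (b 3) * c3
    + 2 * ev3 ρ (b 0) (b 1) (b 4) * c4 - 2 * ev3 ρ (b 0) (b 1) (b 5) * c5

/-- The metric `ω(J_ρ ·, ·)` is symmetric: by a permutation, any two vectors of a basis can take
the places of the first two in `symm_basis`. -/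
theorem IsSU3Structure.ev2_hitchinK_comm (h : IsSU3Structure hV ν hν ω ρ) (x y : V) :
    ev2 ω (hitchinK hV ν hν ρ x) y = ev2 ω (hitchinK hV ν hν ρ y) x := by
  let b : Module.Basis (Fin 6) ℝ V :=
    haveI := Module.finite_of_finrank_pos (R := ℝ) (M := V) (by omega)
    Module.finBasisOfFinrankEq ℝ V hV
  have hB : (bilinOfForm ω).comp (hitchinK hV ν hν ρ) LinearMap.id =
      ((bilinOfForm ω).comp (hitchinK hV ν hν ρ) LinearMap.id).flip := by
    refine LinearMap.ext_basis b b fun i j => ?_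
    change ev2 ω (hitchinK hV ν hν ρ (b i)) (b j) = ev2 ω (hitchinK hV ν hν ρ (b j)) (b i)
    by_cases hij : i = j
    · rw [hij]
    let e : Equiv.Perm (Fin 6) := Equiv.swap 0 i * Equiv.swap 1 (Equiv.swap 0 i j)
    have hk : Equiv.swap 0 i j ≠ 0 := by
      intro h0
      have := congrArg (Equiv.swap 0 i) h0
      rw [Equiv.swap_apply_self, Equiv.swap_apply_left] at this
      exact hij this.symm
    have h0 : e 0 = i := by
      simp only [e, Equiv.Perm.mul_apply]
      rw [Equiv.swap_apply_of_ne_of_ne (by decide) hk.symm, Equiv.swap_apply_left]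
    have h1 : e 1 = j := by
      simp only [e, Equiv.Perm.mul_apply]
      rw [Equiv.swap_apply_left, Equiv.swap_apply_self]
    have h2 := h.symm_basis (b.reindex e.symm)
    simpa [h0, h1] using h2
  exact LinearMap.congr_fun (LinearMap.congr_fun hB x) y

/-- The restriction of the metric to the span of the covectors dual to `b 4` and `b 5`. -/
theorem IsSU3Structure.contractedForm_pair (h : IsSU3Structure hV ν hν ω ρ)
    (b : Module.Basis (Fin 6) ℝ V) :
    0 < contractedForm ω ρ (skip b 4) (skip b 4) * contractedForm ω ρ (skip b 5) (skip b 5) ∧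
      contractedForm ω ρ (skip b 4) (skip b 5) = contractedForm ω ρ (skip b 5) (skip b 4) := by
  let b' : Module.Basis (Fin 6) ℝ V := b.reindex (Equiv.swap 4 5)
  have hb' : (b' : Fin 6 → V) = b ∘ Equiv.swap 4 5 := by
    ext i
    simp [b']
  have hs : skip b' 5 = skip b 4 := by
    rw [hb']
    ext k
    fin_cases k <;> rfl
  have hvol : volTwo ω b' = -volTwo ω b := by
    rw [hb']
    exact AlternatingMap.map_swap (volTwo ω : Form V 6) b (by decide : (4 : Fin 6) ≠ 5)
  have hνb : ν b' = -ν b := by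
    rw [hb']
    exact ν.map_swap b (by decide)
  have h5 := h.contractedForm_pos b
  have h4 := h.contractedForm_pos b'
  rw [hs, hvol, hνb, neg_mul_neg] at h4
  have hvol0 := h.volTwo_basis_ne_zero b
  have hsq : 0 < volTwo ω b * ν b * (volTwo ω b * ν b) :=
    mul_self_pos.2 (left_ne_zero_of_mul h5.ne')
  refine ⟨?_, ?_⟩
  · have h6 := mul_pos h4 h5
    generalize volTwo ω b * ν b = X at h6 hsq
    rw [mul_mul_mul_comm] at h6
    exact (mul_pos_iff_of_pos_left hsq).1 h6
  · have hP := h.ev2_hitchinK_comm (pfaffianVector ω (skip b 5)) (pfaffianVector ω (skip b 4))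
    rw [ev2_swap, ← hs, ev2_pfaffianVector, ev2_swap ω _ (pfaffianVector ω (skip b 5)),
      ev2_pfaffianVector, hs, hvol] at hP
    have hr : ∀ v, b'.repr v 5 = b.repr v 4 := fun v => by simp [b']
    rw [hr] at hP
    have k1 := hitchinK_repr hV ν hν ρ b (pfaffianVector ω (skip b 5)) 4
    have k2 := hitchinK_repr hV ν hν ρ b (pfaffianVector ω (skip b 4)) 5
    have hP' := mul_left_cancel₀ hvol0 (a := volTwo ω b)
      (b := b.repr (hitchinK hV ν hν ρ (pfaffianVector ω (skip b 5))) 4)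
      (c := -b.repr (hitchinK hV ν hν ρ (pfaffianVector ω (skip b 4))) 5)
      (by linear_combination hP / 2)
    rw [hP'] at k1
    rw [contractedForm, contractedForm]
    norm_num at k1 k2
    linear_combination k1 + k2

end Obstruction

/-! ### Closed forms on the product with a two-dimensional Lie algebra -/

section Products

/-- The brackets of a four-dimensional Lie algebra with an ideal of codimension one, unimodular
as a Lie algebra: `e 0, e 1, e 2` span the ideal and diagonalize its bracket, as in Milnor's normal
form for unimodular three-dimensional Lie algebras, and `e 3` acts on it by the matrix `d`. -/
structure IsMilnorFrame {g : Type*} [LieRing g] [LieAlgebra ℝ g] (e : Fin 4 → g)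
    (a : Fin 3 → ℝ) (d : Fin 3 → Fin 3 → ℝ) : Prop where
  lie_one_two : ⁅e 1, e 2⁆ = a 0 • e 0
  lie_two_zero : ⁅e 2, e 0⁆ = a 1 • e 1
  lie_zero_one : ⁅e 0, e 1⁆ = a 2 • e 2
  lie_three_zero : ⁅e 3, e 0⁆ = d 0 0 • e 0 + d 1 0 • e 1 + d 2 0 • e 2
  lie_three_one : ⁅e 3, e 1⁆ = d 0 1 • e 0 + d 1 1 • e 1 + d 2 1 • e 2
  lie_three_two : ⁅e 3, e 2⁆ = d 0 2 • e 0 + d 1 2 • e 1 + d 2 2 • e 2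

variable {g A : Type*} [LieRing g] [LieAlgebra ℝ g] [LieRing A] [LieAlgebra ℝ A]

/-- The basis `e 0, e 1, e 2, f 0, f 1, e 3` of `g × A`. -/
def prodBasis (e : Module.Basis (Fin 4) ℝ g) (f : Module.Basis (Fin 2) ℝ A) :
    Module.Basis (Fin 6) ℝ (g × A) :=
  (e.prod f).reindex
    ⟨Sum.elim ![0, 1, 2, 5] ![3, 4],
      ![Sum.inl 0, Sum.inl 1, Sum.inl 2, Sum.inr 0, Sum.inr 1, Sum.inl 3],
      by decide, by decide⟩

theorem prodBasis_eq (e : Module.Basis (Fin 4) ℝ g) (f : Module.Basis (Fin 2) ℝ A) :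
    (prodBasis e f : Fin 6 → g × A) =
      ![(e 0, 0), (e 1, 0), (e 2, 0), (0, f 0), (0, f 1), (e 3, 0)] := by
  ext i : 1
  fin_cases i <;> simp [prodBasis]

/-- The coordinates, on the complement of one vector, of closed forms `ρ` and `σ` on `g × A`.
With `W` the span of `e 0, e 1, e 2, f 0, f 1`, the restriction of `ρ` to `W` is given by `c`, `x`,
`y`, `γ`, where the two-forms `x`, `y` on the span of `e 0, e 1, e 2` are written as vectors; the
restriction of `σ` to `W` is given by `s`, `s'`, `τ`. The other entries are components of `ρ` and
`σ` in the direction `e 3`, of which only their existence matters. -/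
structure ClosedCoords (a : Fin 3 → ℝ) (d : Fin 3 → Fin 3 → ℝ) (ε : ℝ) where
  (c s s' : ℝ)
  (γ x y τ p q r u v : Fin 3 → ℝ)
  trace_c : (d 0 0 + d 1 1 + d 2 2) * c = 0
  trace_s : (d 0 0 + d 1 1 + d 2 2) * s = 0
  trace_s' : (d 0 0 + d 1 1 + d 2 2) * s' = 0
  closed_x : ∀ k, d k 0 * x 0 + d k 1 * x 1 + d k 2 * x 2 =
    (d 0 0 + d 1 1 + d 2 2) * x k + a k * p k
  closed_y : ∀ k, d k 0 * y 0 + d k 1 * y 1 + d k 2 * y 2 =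
    (d 0 0 + d 1 1 + d 2 2) * y k + a k * q k
  closed_τ : ∀ k, d k 0 * τ 0 + d k 1 * τ 1 + d k 2 * τ 2 =
    (d 0 0 + d 1 1 + d 2 2) * τ k + a k * r k + ε * u k
  closed_γ : ∀ k, a k * γ k = ε * y k
  closed_γ' : ∀ k, d 0 k * γ 0 + d 1 k * γ 1 + d 2 k * γ 2 = ε * v k
  nondegenerate : -(x 0 * (y 1 * τ 2 - y 2 * τ 1) - x 1 * (y 0 * τ 2 - y 2 * τ 0)
      + x 2 * (y 0 * τ 1 - y 1 * τ 0)) + c * (γ 0 * τ 0 + γ 1 * τ 1 + γ 2 * τ 2)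
      + s * (γ 0 * y 0 + γ 1 * y 1 + γ 2 * y 2) - s' * (γ 0 * x 0 + γ 1 * x 1 + γ 2 * x 2) ≠ 0

theorem exists_closedCoords {e : Module.Basis (Fin 4) ℝ g} {f : Module.Basis (Fin 2) ℝ A}
    {a : Fin 3 → ℝ} {d : Fin 3 → Fin 3 → ℝ} {ε : ℝ} (he : IsMilnorFrame e a d)
    (hf : ⁅f 0, f 1⁆ = (-ε) • f 1) (h : AdmitsHalfFlatSU3 (g × A)) :
    Nonempty (ClosedCoords a d ε) := by
  obtain ⟨hL, ν, hν, ω, ρ, hs, hρ, hσ⟩ := h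
  have hne := hs.contractedForm_ne_zero (prodBasis e f)
  have hb := prodBasis_eq e f
  generalize prodBasis e f = b at hne hb
  have l12 : ⁅b 1, b 2⁆ = a 0 • b 0 := by simp [hb, he.lie_one_two]
  have l20 : ⁅b 2, b 0⁆ = a 1 • b 1 := by simp [hb, he.lie_two_zero]
  have l01 : ⁅b 0, b 1⁆ = a 2 • b 2 := by simp [hb, he.lie_zero_one]
  have l50 : ⁅b 5, b 0⁆ = d 0 0 • b 0 + d 1 0 • b 1 + d 2 0 • b 2 := by
    simp [hb, he.lie_three_zero]
  have l51 : ⁅b 5, b 1⁆ = d 0 1 • b 0 + d 1 1 • b 1 + d 2 1 • b 2 := by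
    simp [hb, he.lie_three_one]
  have l52 : ⁅b 5, b 2⁆ = d 0 2 • b 0 + d 1 2 • b 1 + d 2 2 • b 2 := by
    simp [hb, he.lie_three_two]
  have l03 : ⁅b 0, b 3⁆ = 0 := by simp [hb]
  have l13 : ⁅b 1, b 3⁆ = 0 := by simp [hb]
  have l23 : ⁅b 2, b 3⁆ = 0 := by simp [hb]
  have l53 : ⁅b 5, b 3⁆ = 0 := by simp [hb]
  have l04 : ⁅b 0, b 4⁆ = 0 := by simp [hb]
  have l14 : ⁅b 1, b 4⁆ = 0 := by simp [hb]
  have l24 : ⁅b 2, b 4⁆ = 0 := by simp [hb]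
  have l54 : ⁅b 5, b 4⁆ = 0 := by simp [hb]
  have l34 : ⁅b 3, b 4⁆ = (-ε) • b 4 := by simp [hb, hf]
  have l02 : ⁅b 0, b 2⁆ = (-a 1) • b 1 := by rw [← lie_skew, l20, neg_smul]
  clear hb
  have hσ' : ∃ σ : Form (g × A) 4, IsClosedForm (k := 3) σ ∧
      pfaffianVector ω ![b 0, b 1, b 2, b 3, b 4] =
        ev4 σ (b 1) (b 2) (b 3) (b 4) • b 0 + (-ev4 σ (b 0) (b 2) (b 3) (b 4)) • b 1
          + ev4 σ (b 0) (b 1) (b 3) (b 4) • b 2 + (-ev4 σ (b 0) (b 1) (b 2) (b 4)) • b 3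
          + ev4 σ (b 0) (b 1) (b 2) (b 3) • b 4 :=
    by
    refine ⟨wedge (p := 2) (q := 2) ω ω, ?_, ?_⟩
    · exact hσ
    · rfl
  obtain ⟨σ, hσ', hP⟩ := hσ'
  have hu : skip b 5 = ![b 0, b 1, b 2, b 3, b 4] := by
    funext k
    fin_cases k <;> rfl
  rw [hu, contractedForm_apply hP] at hne
  have e3 (i j k : Fin 6) (_ : j < i) : ev3 ρ (b i) (b j) (b k) = -ev3 ρ (b j) (b i) (b k) :=
    ev3_swap _ _ _ _
  have e3' (i j k : Fin 6) (_ : k < j) : ev3 ρ (b i) (b j) (b k) = -ev3 ρ (b i) (b k) (b j) :=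
    ev3_swap' _ _ _ _
  have z3 (x y : g × A) : ev3 ρ x x y = 0 := by linarith [ev3_swap ρ x x y]
  have z3' (x y : g × A) : ev3 ρ x y y = 0 := by linarith [ev3_swap' ρ x y y]
  have e4 (i j k l : Fin 6) (_ : j < i) :
      ev4 σ (b i) (b j) (b k) (b l) = -ev4 σ (b j) (b i) (b k) (b l) := ev4_swap _ _ _ _ _
  have e4' (i j k l : Fin 6) (_ : k < j) :
      ev4 σ (b i) (b j) (b k) (b l) = -ev4 σ (b i) (b k) (b j) (b l) := ev4_swap' _ _ _ _ _
  have z4 (x y z : g × A) : ev4 σ x x y z = 0 := by linarith [ev4_swap σ x x y z]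
  have z4' (x y z : g × A) : ev4 σ x y y z = 0 := by linarith [ev4_swap' σ x y y z]
  have z4'' (x y z : g × A) : ev4 σ x y z z = 0 := by linarith [ev4_swap'' σ x y z z]
  refine ⟨{
    c := ev3 ρ (b 0) (b 1) (b 2)
    s := ev4 σ (b 0) (b 1) (b 2) (b 3)
    s' := ev4 σ (b 0) (b 1) (b 2) (b 4)
    γ := fun k => ev3 ρ (![b 0, b 1, b 2] k) (b 3) (b 4)
    x := ![ev3 ρ (b 1) (b 2) (b 3), ev3 ρ (b 2) (b 0) (b 3), ev3 ρ (b 0) (b 1) (b 3)]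
    y := ![ev3 ρ (b 1) (b 2) (b 4), ev3 ρ (b 2) (b 0) (b 4), ev3 ρ (b 0) (b 1) (b 4)]
    τ := ![ev4 σ (b 1) (b 2) (b 3) (b 4), ev4 σ (b 2) (b 0) (b 3) (b 4),
      ev4 σ (b 0) (b 1) (b 3) (b 4)]
    p := fun k => ev3 ρ (![b 0, b 1, b 2] k) (b 5) (b 3)
    q := fun k => ev3 ρ (![b 0, b 1, b 2] k) (b 5) (b 4)
    r := fun k => ev4 σ (![b 0, b 1, b 2] k) (b 5) (b 3) (b 4)
    u := ![-ev4 σ (b 4) (b 5) (b 1) (b 2), -ev4 σ (b 4) (b 5) (b 2) (b 0),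
      -ev4 σ (b 4) (b 5) (b 0) (b 1)]
    v := fun k => ev3 ρ (b 4) (b 5) (![b 0, b 1, b 2] k)
    trace_c := ?_, trace_s := ?_, trace_s' := ?_, closed_x := ?_, closed_y := ?_
    closed_τ := ?_, closed_γ := ?_, closed_γ' := ?_, nondegenerate := ?_ }⟩
  · have h := hρ.ev3 (b 5) (b 0) (b 1) (b 2)
    simp [l50, l51, l52, l01, l02, l12, ev3_add, ev3_smul, ev3_neg, e3, e3', z3, z3'] at h
    linear_combination -h
  · have h := hσ'.ev4 (b 5) (b 0) (b 1) (b 2) (b 3)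
    simp [l50, l51, l52, l01, l02, l12, l53, l03, l13, l23, ev4_add, ev4_smul, ev4_neg, ev4_zero, e4,
      e4', z4, z4'] at h
    linear_combination -h
  · have h := hσ'.ev4 (b 5) (b 0) (b 1) (b 2) (b 4)
    simp [l50, l51, l52, l01, l02, l12, l54, l04, l14, l24, ev4_add, ev4_smul, ev4_neg, ev4_zero, e4,
      e4', z4, z4'] at h
    linear_combination -h
  · have h0 := hρ.ev3 (b 5) (b 1) (b 2) (b 3)
    have h1 := hρ.ev3 (b 5) (b 2) (b 0) (b 3)
    have h2 := hρ.ev3 (b 5) (b 0) (b 1) (b 3)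
    simp [l50, l51, l52, l01, l12, l20, l53, l03, l13, l23, ev3_add, ev3_smul, ev3_zero, e3, e3',
      z3] at h0 h1 h2
    intro k
    fin_cases k <;> simp [e3, e3']
    · linear_combination h0
    · linear_combination h1
    · linear_combination h2
  · have h0 := hρ.ev3 (b 5) (b 1) (b 2) (b 4)
    have h1 := hρ.ev3 (b 5) (b 2) (b 0) (b 4)
    have h2 := hρ.ev3 (b 5) (b 0) (b 1) (b 4)
    simp [l50, l51, l52, l01, l12, l20, l54, l04, l14, l24, ev3_add, ev3_smul, ev3_zero, e3, e3',
      z3] at h0 h1 h2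
    intro k
    fin_cases k <;> simp [e3, e3']
    · linear_combination h0
    · linear_combination h1
    · linear_combination h2
  · have h0 := hσ'.ev4 (b 5) (b 1) (b 2) (b 3) (b 4)
    have h1 := hσ'.ev4 (b 5) (b 2) (b 0) (b 3) (b 4)
    have h2 := hσ'.ev4 (b 5) (b 0) (b 1) (b 3) (b 4)
    simp [l50, l51, l52, l01, l12, l20, l53, l03, l13, l23, l54, l04, l14, l24, l34, ev4_add,
      ev4_smul, ev4_neg, ev4_zero, e4, e4', z4] at h0 h1 h2
    intro k
    fin_cases k <;> simp [e4, e4']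
    · linear_combination h0
    · linear_combination h1
    · linear_combination h2
  · have h0 := hρ.ev3 (b 1) (b 2) (b 3) (b 4)
    have h1 := hρ.ev3 (b 2) (b 0) (b 3) (b 4)
    have h2 := hρ.ev3 (b 0) (b 1) (b 3) (b 4)
    simp [l01, l12, l20, l03, l13, l23, l04, l14, l24, l34, ev3_smul, ev3_neg, ev3_zero,
      e3, e3'] at h0 h1 h2
    intro k
    fin_cases k <;> simp [e3]
    · linear_combination -h0
    · linear_combination -h1
    · linear_combination -h2
  · have h0 := hρ.ev3 (b 5) (b 0) (b 3) (b 4)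
    have h1 := hρ.ev3 (b 5) (b 1) (b 3) (b 4)
    have h2 := hρ.ev3 (b 5) (b 2) (b 3) (b 4)
    simp [l50, l51, l52, l03, l13, l23, l53, l04, l14, l24, l54, l34, ev3_add, ev3_smul, ev3_neg,
      ev3_zero, e3, e3'] at h0 h1 h2
    intro k
    fin_cases k <;> simp [e3, e3']
    · linear_combination -h0
    · linear_combination -h1
    · linear_combination -h2
  · intro h0
    refine hne ?_
    simp [ev3_add, ev3_smul, ev3_neg, e3, e3', z3, z3', e4] at h0 ⊢
    linear_combination 2 * h0
end Products

/-! ### Decomposability -/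

section Decomposability

variable {g : Type*} [LieRing g] [LieAlgebra ℝ g]

/-- The bracket as a bilinear map. -/
def lieBilin (g : Type*) [LieRing g] [LieAlgebra ℝ g] : g →ₗ[ℝ] g →ₗ[ℝ] g :=
  LinearMap.mk₂ ℝ (fun x y => ⁅x, y⁆) add_lie smul_lie lie_add fun c x y => lie_smul c x y

theorem map_lie_of_basis {ι h : Type*} [LieRing h] [LieAlgebra ℝ h] (e : Module.Basis ι ℝ g)
    (f : g →ₗ[ℝ] h) (H : ∀ i j, f ⁅e i, e j⁆ = ⁅f (e i), f (e j)⁆) (x y : g) :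
    f ⁅x, y⁆ = ⁅f x, f y⁆ := by
  have h1 : (lieBilin g).compr₂ f =
      (lieBilin h).compl₁₂ f f := LinearMap.ext_basis e e H
  exact LinearMap.congr_fun (LinearMap.congr_fun h1 x) y

theorem centroid_of_basis {ι : Type*} (e : Module.Basis ι ℝ g)
    (p : g →ₗ[ℝ] g) (H : ∀ i j, p ⁅e i, e j⁆ = ⁅e i, p (e j)⁆) (x y : g) :
    p ⁅x, y⁆ = ⁅x, p y⁆ := by
  have h1 : (lieBilin g).compr₂ p =
      (lieBilin g).compl₁₂ LinearMap.id p := LinearMap.ext_basis e e H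
  exact LinearMap.congr_fun (LinearMap.congr_fun h1 x) y

theorem closed_of_basis {ι : Type*} [LinearOrder ι] (e : Module.Basis ι ℝ g)
    (f : g →ₗ[ℝ] ℝ) (H : ∀ i j, j < i → f ⁅e i, e j⁆ = 0) (x y : g) : f ⁅x, y⁆ = 0 := by
  have h1 : (lieBilin g).compr₂ f = 0 := LinearMap.ext_basis e e fun i j => by
    change f ⁅e i, e j⁆ = 0
    rcases lt_trichotomy i j with hij | rfl | hij
    · rw [← lie_skew, map_neg, H j i hij, neg_zero]
    · rw [lie_self, map_zero]
    · exact H i j hij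
  exact LinearMap.congr_fun (LinearMap.congr_fun h1 x) y

theorem central_of_basis {ι : Type*} (e : Module.Basis ι ℝ g) (z : g)
    (H : ∀ i, ⁅e i, z⁆ = 0) (x : g) : ⁅x, z⁆ = 0 := by
  have h1 : LieAlgebra.ad ℝ g z = 0 := e.ext fun i => by
    change ⁅z, e i⁆ = 0
    rw [← lie_skew, H, neg_zero]
  rw [← lie_skew]
  exact neg_eq_zero.2 (LinearMap.congr_fun h1 x)

/-- The kernel and the range of an idempotent in the centroid are complementary ideals. -/
theorem IsIndecomposable.idempotent_eq (h : IsIndecomposable g) (p : g →ₗ[ℝ] g)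
    (hlie : ∀ x y : g, p ⁅x, y⁆ = ⁅x, p y⁆) (hp : ∀ x, p (p x) = p x) :
    p = 0 ∨ p = LinearMap.id := by
  let I : LieIdeal ℝ g :=
    { LinearMap.ker p with
      lie_mem := fun {x m} hm => by
        have hm' : p m = 0 := hm
        change p ⁅x, m⁆ = 0
        rw [hlie, hm', lie_zero] }
  let J : LieIdeal ℝ g :=
    { LinearMap.range p with
      lie_mem := fun {x m} hm => by
        obtain ⟨y, rfl⟩ := hm
        exact ⟨⁅x, y⁆, hlie x y⟩ }
  have hI : ∀ x, x ∈ I ↔ p x = 0 := fun x => Iff.rfl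
  have hJ : ∀ x, x ∈ J ↔ ∃ y, p y = x := fun x => Iff.rfl
  have hIJ : IsCompl I J := by
    refine ⟨disjoint_iff_inf_le.2 fun x hx => ?_, codisjoint_iff_le_sup.2 fun x _ => ?_⟩
    · obtain ⟨h1, h2⟩ := (LieSubmodule.mem_inf I J x).1 hx
      obtain ⟨y, rfl⟩ := (hJ _).1 h2
      rw [LieSubmodule.mem_bot, ← hp y]
      exact h1
    · refine (LieSubmodule.mem_sup _ _ _).2 ⟨x - p x, ?_, p x, ⟨x, rfl⟩, sub_add_cancel x (p x)⟩
      rw [hI, map_sub, hp, sub_self]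
  rcases h.2 I J hIJ with h0 | h0
  · right
    ext x
    have hx : x - p x ∈ I := by rw [hI, map_sub, hp, sub_self]
    rw [h0, LieSubmodule.mem_bot] at hx
    exact (sub_eq_zero.1 hx).symm
  · left
    ext x
    have hx : p x ∈ J := ⟨x, rfl⟩
    rw [h0, LieSubmodule.mem_bot] at hx
    exact hx

/-- A central vector outside the kernel of a closed one-form splits off. -/
theorem IsIndecomposable.closed_central_eq_zero (h : IsIndecomposable g)
    (hg : 1 < Module.finrank ℝ g) (f : g →ₗ[ℝ] ℝ) (hf : ∀ x y : g, f ⁅x, y⁆ = 0)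
    (z : g) (hz : ∀ x : g, ⁅x, z⁆ = 0) : f z = 0 := by
  by_contra h0
  let p : g →ₗ[ℝ] g := f.smulRight ((f z)⁻¹ • z)
  have hp : ∀ x, p x = f x • (f z)⁻¹ • z := fun x => rfl
  rcases h.idempotent_eq p (fun x y => by simp [hp, hf, hz]) (fun x => by
    simp [hp, h0]) with h1 | h1
  · have h2 := LinearMap.congr_fun h1 z
    rw [hp, smul_smul, mul_inv_cancel₀ h0, one_smul, LinearMap.zero_apply] at h2
    exact h0 (by rw [h2, map_zero])
  · have h2 : ∀ x, ∃ c : ℝ, c • z = x := fun x =>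
      ⟨f x * (f z)⁻¹, by rw [mul_smul, ← hp, h1, LinearMap.id_apply]⟩
    exact absurd (finrank_le_one z h2) (by omega)

end Decomposability

section MilnorFrames

variable {g : Type*} [LieRing g] [LieAlgebra ℝ g] {e : Module.Basis (Fin 4) ℝ g} {a : Fin 3 → ℝ}
  {d : Fin 3 → Fin 3 → ℝ}

/-- The Jacobi identity says that `d` is a derivation of the ideal. -/
theorem IsMilnorFrame.derivation (h : IsMilnorFrame e a d) :
    (a 0 * (d 0 0 - d 1 1 - d 2 2) = 0 ∧ a 1 * (d 1 1 - d 2 2 - d 0 0) = 0 ∧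
      a 2 * (d 2 2 - d 0 0 - d 1 1) = 0) ∧
    (a 0 * d 1 0 + a 1 * d 0 1 = 0 ∧ a 1 * d 2 1 + a 2 * d 1 2 = 0 ∧
      a 2 * d 0 2 + a 0 * d 2 0 = 0) := by
  have r10 : ⁅e 1, e 0⁆ = -(a 2 • e 2) := by rw [← lie_skew, h.lie_zero_one]
  have r21 : ⁅e 2, e 1⁆ = -(a 0 • e 0) := by rw [← lie_skew, h.lie_one_two]
  have r02 : ⁅e 0, e 2⁆ = -(a 1 • e 1) := by rw [← lie_skew, h.lie_two_zero]
  have h0 := congrArg e.repr (leibniz_lie (e 3) (e 1) (e 2))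
  have h1 := congrArg e.repr (leibniz_lie (e 3) (e 2) (e 0))
  have h2 := congrArg e.repr (leibniz_lie (e 3) (e 0) (e 1))
  simp only [r10, r21, r02, h.lie_one_two, h.lie_two_zero, h.lie_zero_one, h.lie_three_zero,
    h.lie_three_one, h.lie_three_two, lie_add, add_lie, lie_smul, smul_lie, lie_self] at h0 h1 h2
  have h00 := DFunLike.congr_fun h0 0
  have h01 := DFunLike.congr_fun h0 1
  have h11 := DFunLike.congr_fun h1 1
  have h12 := DFunLike.congr_fun h1 2
  have h22 := DFunLike.congr_fun h2 2
  have h20 := DFunLike.congr_fun h2 0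
  simp at h00 h01 h11 h12 h22 h20
  refine ⟨⟨?_, ?_, ?_⟩, ?_, ?_, ?_⟩
  · linear_combination h00
  · linear_combination h11
  · linear_combination h22
  · linear_combination h01
  · linear_combination h12
  · linear_combination h20

theorem IsMilnorFrame.finrank_eq (_ : IsMilnorFrame e a d) : Module.finrank ℝ g = 4 := by
  simp [Module.finrank_eq_card_basis e]

/-- The central vector `Σ zᵢ eᵢ + t e₃` lies in the kernel of every closed one-form; the one-form
with coefficients `γ`, `s` is closed if it vanishes on all brackets. -/
theorem IsMilnorFrame.pairing_eq_zero (h : IsMilnorFrame e a d) (hg : IsIndecomposable g)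
    (z γ : Fin 3 → ℝ) (t s : ℝ)
    (hγ : ∀ k, a k * γ k = 0)
    (hγd : ∀ k, d 0 k * γ 0 + d 1 k * γ 1 + d 2 k * γ 2 = 0)
    (hzd : ∀ k, d k 0 * z 0 + d k 1 * z 1 + d k 2 * z 2 = 0)
    (h00 : t * d 0 0 = 0) (h11 : t * d 1 1 = 0) (h22 : t * d 2 2 = 0)
    (h10 : t * d 1 0 = -(z 2 * a 1)) (h20 : t * d 2 0 = z 1 * a 2)
    (h01 : t * d 0 1 = z 2 * a 0) (h21 : t * d 2 1 = -(z 0 * a 2))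
    (h02 : t * d 0 2 = -(z 1 * a 0)) (h12 : t * d 1 2 = z 0 * a 1) :
    γ 0 * z 0 + γ 1 * z 1 + γ 2 * z 2 + s * t = 0 := by
  have r10 : ⁅e 1, e 0⁆ = -(a 2 • e 2) := by rw [← lie_skew, h.lie_zero_one]
  have r21 : ⁅e 2, e 1⁆ = -(a 0 • e 0) := by rw [← lie_skew, h.lie_one_two]
  have r02 : ⁅e 0, e 2⁆ = -(a 1 • e 1) := by rw [← lie_skew, h.lie_two_zero]
  have r3 : ∀ i, ⁅e i, e 3⁆ = -⁅e 3, e i⁆ := fun i => (lie_skew _ _).symm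
  let f : g →ₗ[ℝ] ℝ := e.constr ℝ ![γ 0, γ 1, γ 2, s]
  have hfe : ∀ i, f (e i) = ![γ 0, γ 1, γ 2, s] i := fun i => e.constr_basis ℝ _ i
  have hf := closed_of_basis e f fun i j hij => by
    fin_cases i <;> fin_cases j <;>
      simp [r10, r21, h.lie_two_zero, h.lie_three_zero, h.lie_three_one, h.lie_three_two, hfe]
        at hij ⊢
    · simpa using hγ 2
    · simpa using hγ 1
    · simpa using hγ 0
    · exact hγd 0
    · exact hγd 1
    · exact hγd 2
  have hz := central_of_basis e (z 0 • e 0 + z 1 • e 1 + z 2 • e 2 + t • e 3) fun i => by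
    have hz0 := hzd 0
    have hz1 := hzd 1
    have hz2 := hzd 2
    refine e.ext_elem fun j => ?_
    fin_cases i <;>
      simp [r3, r10, r21, r02, h.lie_one_two, h.lie_two_zero, h.lie_zero_one, h.lie_three_zero,
        h.lie_three_one, h.lie_three_two] <;>
      fin_cases j <;> simp [-mul_eq_zero] <;> linarith
  have h1 := hg.closed_central_eq_zero (by rw [h.finrank_eq]; norm_num) f hf _ hz
  simp [hfe] at h1
  linear_combination h1

/-- If `d` is an inner derivation of the ideal, then a central vector splits off. -/
theorem IsMilnorFrame.not_inner (h : IsMilnorFrame e a d) (hg : IsIndecomposable g) (w : Fin 3 → ℝ)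
    (h00 : d 0 0 = 0) (h11 : d 1 1 = 0) (h22 : d 2 2 = 0)
    (h10 : d 1 0 = w 2 * a 1) (h20 : d 2 0 = -(w 1 * a 2))
    (h01 : d 0 1 = -(w 2 * a 0)) (h21 : d 2 1 = w 0 * a 2)
    (h02 : d 0 2 = w 1 * a 0) (h12 : d 1 2 = -(w 0 * a 1)) : False := by
  have h1 := h.pairing_eq_zero hg (fun k => -w k) 0 1 1 (by simp) (by simp)
    (fun k => by fin_cases k <;> simp [h00, h11, h22, h10, h20, h01, h21, h02, h12] <;> ring)
    (by simp [h00]) (by simp [h11]) (by simp [h22]) (by simp [h10]) (by simp [h20])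
    (by simp [h01]) (by simp [h21]) (by simp [h02]) (by simp [h12])
  simp at h1

end MilnorFrames

/-! ### The sum with the abelian algebra -/

section Abelian

/-- A vector orthogonal to three vectors with non-zero determinant vanishes. -/
theorem eq_zero_of_det_ne_zero {x y z m : Fin 3 → ℝ}
    (hD : x 0 * (y 1 * z 2 - y 2 * z 1) - x 1 * (y 0 * z 2 - y 2 * z 0)
      + x 2 * (y 0 * z 1 - y 1 * z 0) ≠ 0)
    (hx : m 0 * x 0 + m 1 * x 1 + m 2 * x 2 = 0) (hy : m 0 * y 0 + m 1 * y 1 + m 2 * y 2 = 0)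
    (hz : m 0 * z 0 + m 1 * z 1 + m 2 * z 2 = 0) : m 0 = 0 ∧ m 1 = 0 ∧ m 2 = 0 := by
  refine ⟨?_, ?_, ?_⟩ <;> refine (mul_eq_zero.1 (?_ : _ * (_ : ℝ) = 0)).resolve_right hD
  · linear_combination (y 1 * z 2 - y 2 * z 1) * hx - (x 1 * z 2 - x 2 * z 1) * hy
      + (x 1 * y 2 - x 2 * y 1) * hz
  · linear_combination -(y 0 * z 2 - y 2 * z 0) * hx + (x 0 * z 2 - x 2 * z 0) * hy
      - (x 0 * y 2 - x 2 * y 0) * hz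
  · linear_combination (y 0 * z 1 - y 1 * z 0) * hx - (x 0 * z 1 - x 1 * z 0) * hy
      + (x 0 * y 1 - x 1 * y 0) * hz

variable {g : Type*} [LieRing g] [LieAlgebra ℝ g] {e : Module.Basis (Fin 4) ℝ g} {a : Fin 3 → ℝ}
  {d : Fin 3 → Fin 3 → ℝ}

/-- The standard basis of a Lie algebra given by a bracket on a coordinate space. -/
def coordBasis {n : ℕ} (b : CoordBracket n) : Module.Basis (Fin n) ℝ b.Carrier :=
  Pi.basisFun ℝ (Fin n)

theorem coordBasis_apply {n : ℕ} (b : CoordBracket n) (i j : Fin n) :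
    coordBasis b i j = if j = i then (1 : ℝ) else 0 := by
  have h : coordBasis b i = (Pi.single i (1 : ℝ) : Fin n → ℝ) := Pi.basisFun_apply ℝ (Fin n) i
  rw [h, Pi.single_apply]

/-- On `n = ⟨e 0, e 1, e 2⟩`, a linear independent triple of closed two-forms forces `d` to act on
`n / [n, n]` as the scalar `tr d`. -/
theorem ClosedCoords.row_eq (C : ClosedCoords a d 0)
    (hD : C.x 0 * (C.y 1 * C.τ 2 - C.y 2 * C.τ 1) - C.x 1 * (C.y 0 * C.τ 2 - C.y 2 * C.τ 0)
      + C.x 2 * (C.y 0 * C.τ 1 - C.y 1 * C.τ 0) ≠ 0) (k : Fin 3) (hk : a k = 0) :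
    ∀ j, d k j = if j = k then d 0 0 + d 1 1 + d 2 2 else 0 := by
  have hx := C.closed_x k
  have hy := C.closed_y k
  have hτ := C.closed_τ k
  rw [hk] at hx hy hτ
  have h := eq_zero_of_det_ne_zero hD
    (m := fun j => d k j - if j = k then d 0 0 + d 1 1 + d 2 2 else 0)
    (by fin_cases k <;> simp at hx ⊢ <;> linear_combination hx)
    (by fin_cases k <;> simp at hy ⊢ <;> linear_combination hy)
    (by fin_cases k <;> simp at hτ ⊢ <;> linear_combination hτ)
  intro j
  fin_cases j
  · exact sub_eq_zero.1 h.1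
  · exact sub_eq_zero.1 h.2.1
  · exact sub_eq_zero.1 h.2.2

/-- If `tr d ≠ 0`, the obstruction reduces to the determinant of the three closed two-forms, which
forces `d` to have too large a trace. If `tr d = 0`, then either `d` is an inner derivation of the
ideal, or one of the two-forms, read as a vector, is central and pairs non-trivially with the closed
one-form `γ`; in both cases `g` is decomposable. -/
theorem IsMilnorFrame.not_admits_R2 (h : IsMilnorFrame e a d) (hg : IsIndecomposable g)
    (ha₁ : a 0 = 0 → a 1 = 0) (ha₂ : a 1 = 0 → a 2 = 0) : ¬ AdmitsHalfFlatSU3 (g × R2) := by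
  intro hadm
  have hf : ⁅coordBasis R2Bracket 0, coordBasis R2Bracket 1⁆ =
      (-0 : ℝ) • coordBasis R2Bracket 1 := by
    rw [neg_zero, zero_smul]
    rfl
  obtain ⟨C⟩ := exists_closedCoords h hf hadm
  obtain ⟨⟨j0, j1, j2⟩, k0, k1, k2⟩ := h.derivation
  have row := C.row_eq
  set D := C.x 0 * (C.y 1 * C.τ 2 - C.y 2 * C.τ 1) - C.x 1 * (C.y 0 * C.τ 2 - C.y 2 * C.τ 0)
      + C.x 2 * (C.y 0 * C.τ 1 - C.y 1 * C.τ 0) with hDdef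
  have hnd := C.nondegenerate
  rw [← hDdef] at hnd
  have hγ : ∀ k, a k * C.γ k = 0 := fun k => by simpa using C.closed_γ k
  have hγd : ∀ k, d 0 k * C.γ 0 + d 1 k * C.γ 1 + d 2 k * C.γ 2 = 0 := fun k => by
    simpa using C.closed_γ' k
  -- If the triple is linearly dependent, `γ` is non-zero on one of its members.
  have hw : D = 0 → ∃ w p : Fin 3 → ℝ, (∀ k, d k 0 * w 0 + d k 1 * w 1 + d k 2 * w 2 =
      (d 0 0 + d 1 1 + d 2 2) * w k + a k * p k) ∧
      C.γ 0 * w 0 + C.γ 1 * w 1 + C.γ 2 * w 2 ≠ 0 := by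
    intro hD
    by_contra! hcon
    have e1 := hcon C.x C.p C.closed_x
    have e2 := hcon C.y C.q C.closed_y
    have e3 := hcon C.τ C.r (fun k => by simpa using C.closed_τ k)
    exact hnd (by rw [hD, e1, e2, e3]; ring)
  by_cases ht : d 0 0 + d 1 1 + d 2 2 = 0
  · by_cases h0 : a 0 = 0
    · have h1 := ha₁ h0
      have h2 := ha₂ h1
      by_cases hD : D = 0
      · obtain ⟨w, p, hwd, hγw⟩ := hw hD
        refine hγw ?_
        have := h.pairing_eq_zero hg w C.γ 0 0 hγ hγd (fun k => by
          rw [hwd k, ht]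
          fin_cases k <;> simp [h0, h1, h2]) (by simp) (by simp) (by simp) (by simp [h1])
          (by simp [h2]) (by simp [h0]) (by simp [h2]) (by simp [h0]) (by simp [h1])
        linear_combination this
      · have r0 := row hD 0 h0
        have r1 := row hD 1 h1
        have r2 := row hD 2 h2
        simp only [ht] at r0 r1 r2
        refine h.not_inner hg 0 ?_ ?_ ?_ ?_ ?_ ?_ ?_ ?_ ?_ <;> simp [r0, r1, r2]
    · have j0' := (mul_eq_zero.1 j0).resolve_left h0
      by_cases h1 : a 1 = 0
      · have h2 := ha₂ h1
        have d10 : d 1 0 = 0 := by simpa [h1, h0] using k0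
        have d20 : d 2 0 = 0 := by simpa [h2, h0] using k2
        have key : d 1 1 = 0 ∧ d 1 2 = 0 ∧ d 2 1 = 0 := by
          by_cases hD : D = 0
          · obtain ⟨w, p, hwd, hγw⟩ := hw hD
            have g0 : C.γ 0 = 0 := (mul_eq_zero.1 (hγ 0)).resolve_left h0
            have w1 := hwd 1
            have w2 := hwd 2
            have g1 := hγd 1
            have g2 := hγd 2
            have h22 : d 2 2 = -d 1 1 := by linarith
            have h00 : d 0 0 = 0 := by linarith
            simp only [h1, h2, d10, d20, g0, h22, h00] at w1 w2 g1 g2 hγw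
            refine ⟨?_, ?_, ?_⟩ <;> refine (mul_eq_zero.1 (?_ : _ * (_ : ℝ) = 0)).resolve_right hγw
            · linear_combination C.γ 1 * w1 + w 2 * (-g2)
            · linear_combination w 1 * g2 + C.γ 2 * w1
            · linear_combination C.γ 1 * w2 + w 2 * g1
          · have r1 := row hD 1 h1
            have r2 := row hD 2 h2
            simp only [ht] at r1 r2
            simp [r1, r2]
        obtain ⟨d11, d12, d21⟩ := key
        have d00 : d 0 0 = 0 := by linarith
        have d22 : d 2 2 = 0 := by linarith
        refine h.not_inner hg ![0, d 0 2 / a 0, -(d 0 1 / a 0)] ?_ ?_ ?_ ?_ ?_ ?_ ?_ ?_ ?_ <;>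
          simp [*]
      · have j1' := (mul_eq_zero.1 j1).resolve_left h1
        have d22 : d 2 2 = 0 := by linarith
        have d00 : d 0 0 = 0 := by linarith
        have d11 : d 1 1 = 0 := by linarith
        refine h.not_inner hg ![-(d 1 2 / a 1), d 0 2 / a 0, d 1 0 / a 1] d00 d11 d22
          ?_ ?_ ?_ ?_ ?_ ?_ <;> simp <;> field_simp <;> linarith
  · have hc : C.c = 0 := (mul_eq_zero.1 C.trace_c).resolve_left ht
    have hs : C.s = 0 := (mul_eq_zero.1 C.trace_s).resolve_left ht
    have hs' : C.s' = 0 := (mul_eq_zero.1 C.trace_s').resolve_left ht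
    have hD : D ≠ 0 := fun hD => hnd (by rw [hD, hc, hs, hs']; ring)
    refine ht ?_
    by_cases h0 : a 0 = 0
    · have r0 := row hD 0 h0 0
      have r1 := row hD 1 (ha₁ h0) 1
      have r2 := row hD 2 (ha₂ (ha₁ h0)) 2
      simp at r0 r1 r2
      linarith
    · have j0' := (mul_eq_zero.1 j0).resolve_left h0
      by_cases h1 : a 1 = 0
      · have r1 := row hD 1 h1 1
        have r2 := row hD 2 (ha₂ h1) 2
        simp at r1 r2
        linarith
      · have j1' := (mul_eq_zero.1 j1).resolve_left h1
        by_cases h2 : a 2 = 0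
        · have r2 := row hD 2 h2 2
          simp at r2
          linarith
        · have j2' := (mul_eq_zero.1 j2).resolve_left h2
          linarith

end Abelian

/-! ### The sum with the non-abelian two-dimensional algebra -/

section NonAbelian

variable {g : Type*} [LieRing g] [LieAlgebra ℝ g] {e : Module.Basis (Fin 4) ℝ g} {a : Fin 3 → ℝ}
  {d : Fin 3 → Fin 3 → ℝ}

/-- Four linearly independent vectors of a four-dimensional space form a basis. -/
theorem exists_basis_of_injective (e : Module.Basis (Fin 4) ℝ g) (v : Fin 4 → g)
    (h : ∀ c : Fin 4 → ℝ, c 0 • v 0 + c 1 • v 1 + c 2 • v 2 + c 3 • v 3 = 0 →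
      c 0 = 0 ∧ c 1 = 0 ∧ c 2 = 0 ∧ c 3 = 0) :
    ∃ b : Module.Basis (Fin 4) ℝ g, (b : Fin 4 → g) = v := by
  have hli : LinearIndependent ℝ v := by
    refine Fintype.linearIndependent_iff.2 fun c hc => ?_
    rw [Fin.sum_univ_four] at hc
    obtain ⟨h0, h1, h2, h3⟩ := h c hc
    intro i
    fin_cases i <;> assumption
  exact ⟨basisOfLinearIndependentOfCardEqFinrank hli (by simp [Module.finrank_eq_card_basis e]),
    coe_basisOfLinearIndependentOfCardEqFinrank _ _⟩

/-- Replacing `e 3` by `r (e 3 - w)` with `w` in the ideal scales `d` and changes it by an inner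
derivation. -/
theorem IsMilnorFrame.exists_shift (h : IsMilnorFrame e a d) (w : Fin 3 → ℝ) {r : ℝ} (hr : r ≠ 0) :
    ∃ e' : Module.Basis (Fin 4) ℝ g, IsMilnorFrame e' a
      ![![r * d 0 0, r * (d 0 1 + w 2 * a 0), r * (d 0 2 - w 1 * a 0)],
        ![r * (d 1 0 - w 2 * a 1), r * d 1 1, r * (d 1 2 + w 0 * a 1)],
        ![r * (d 2 0 + w 1 * a 2), r * (d 2 1 - w 0 * a 2), r * d 2 2]] := by
  obtain ⟨b, hb⟩ := exists_basis_of_injective e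
    ![e 0, e 1, e 2, r • (e 3 - w 0 • e 0 - w 1 • e 1 - w 2 • e 2)] fun c hc => by
      have h0 := congrArg (fun x => e.repr x 0) hc
      have h1 := congrArg (fun x => e.repr x 1) hc
      have h2 := congrArg (fun x => e.repr x 2) hc
      have h3 := congrArg (fun x => e.repr x 3) hc
      simp [hr] at h0 h1 h2 h3
      simp [h3] at h0 h1 h2
      exact ⟨h0, h1, h2, h3⟩
  have r10 : ⁅e 1, e 0⁆ = -(a 2 • e 2) := by rw [← lie_skew, h.lie_zero_one]
  have r21 : ⁅e 2, e 1⁆ = -(a 0 • e 0) := by rw [← lie_skew, h.lie_one_two]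
  have r02 : ⁅e 0, e 2⁆ = -(a 1 • e 1) := by rw [← lie_skew, h.lie_two_zero]
  refine ⟨b, ?_, ?_, ?_, ?_, ?_, ?_⟩ <;>
    simp [hb, h.lie_one_two, h.lie_two_zero, h.lie_zero_one, h.lie_three_zero, h.lie_three_one,
      h.lie_three_two, r10, r21, r02] <;> module

theorem nonempty_lieEquiv_of_basis {h : Type*} [LieRing h] [LieAlgebra ℝ h] {n : ℕ}
    (F : Module.Basis (Fin n) ℝ g) (E : Module.Basis (Fin n) ℝ h)
    (H : ∀ i j, j < i → F.equiv E (Equiv.refl _) ⁅F i, F j⁆ = ⁅E i, E j⁆) :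
    Nonempty (g ≃ₗ⁅ℝ⁆ h) := by
  let φ := F.equiv E (Equiv.refl _)
  have hφ : ∀ i, φ (F i) = E i := fun i => by simp [φ]
  have hm := map_lie_of_basis F (φ : g →ₗ[ℝ] h) fun i j => by
    change φ ⁅F i, F j⁆ = ⁅φ (F i), φ (F j)⁆
    rw [hφ, hφ]
    rcases lt_trichotomy i j with hij | rfl | hij
    · rw [← lie_skew, map_neg, H j i hij, lie_skew]
    · rw [lie_self, lie_self, map_zero]
    · exact H i j hij
  exact ⟨{ φ with map_lie' := fun {x y} => hm x y }⟩

/-- A frame of `A_{4,9}^{-1/2}`. -/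
theorem nonempty_lieEquiv_A49 (F : Module.Basis (Fin 4) ℝ g)
    (h10 : ⁅F 1, F 0⁆ = 0) (h20 : ⁅F 2, F 0⁆ = 0) (h21 : ⁅F 2, F 1⁆ = F 0)
    (h30 : ⁅F 3, F 0⁆ = (1 / 2 : ℝ) • F 0) (h31 : ⁅F 3, F 1⁆ = F 1)
    (h32 : ⁅F 3, F 2⁆ = (-1 / 2 : ℝ) • F 2) : Nonempty (g ≃ₗ⁅ℝ⁆ A49 (-1 / 2)) := by
  refine nonempty_lieEquiv_of_basis F (coordBasis (A49Bracket (-1 / 2))) fun i j hij => ?_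
  have hb : ∀ (x y : A49 (-1 / 2)) (k : Fin 4), ⁅x, y⁆ k =
      -![((-1 / 2 : ℝ) + 1) * coordWedge 0 3 x y + coordWedge 1 2 x y, coordWedge 1 3 x y,
        (-1 / 2 : ℝ) * coordWedge 2 3 x y, 0] k := fun _ _ _ => rfl
  have hc := coordBasis_apply (A49Bracket (-1 / 2))
  have hs : ∀ (c : ℝ) (x : A49 (-1 / 2)) (k : Fin 4), (c • x) k = c * x k := fun _ _ _ => rfl
  have h0 : ∀ (k : Fin 4), (0 : A49 (-1 / 2)) k = 0 := fun _ => rfl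
  funext k
  rw [hb]
  fin_cases i <;> fin_cases j <;> simp at hij <;>
    simp [h10, h20, h21, h30, h31, h32, hs, h0, hc, coordWedge] <;>
    fin_cases k <;> (simp; try norm_num)

/-- A frame of `A_{4,12}`. -/
theorem nonempty_lieEquiv_A412 (F : Module.Basis (Fin 4) ℝ g)
    (h10 : ⁅F 1, F 0⁆ = 0) (h20 : ⁅F 2, F 0⁆ = F 0) (h21 : ⁅F 2, F 1⁆ = F 1)
    (h30 : ⁅F 3, F 0⁆ = -F 1) (h31 : ⁅F 3, F 1⁆ = F 0)
    (h32 : ⁅F 3, F 2⁆ = 0) : Nonempty (g ≃ₗ⁅ℝ⁆ A412) := by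
  refine nonempty_lieEquiv_of_basis F (coordBasis A412Bracket) fun i j hij => ?_
  have hb : ∀ (x y : A412) (k : Fin 4), ⁅x, y⁆ k =
      -![coordWedge 0 2 x y + coordWedge 1 3 x y, coordWedge 3 0 x y + coordWedge 1 2 x y,
        0, 0] k := fun _ _ _ => rfl
  have hc := coordBasis_apply A412Bracket
  have hn : ∀ (x : A412) (k : Fin 4), (-x) k = -x k := fun _ _ => rfl
  have h0 : ∀ (k : Fin 4), (0 : A412) k = 0 := fun _ => rfl
  funext k
  rw [hb]
  fin_cases i <;> fin_cases j <;> simp at hij <;>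
    simp [h10, h20, h21, h30, h31, h32, hn, h0, hc, coordWedge] <;>
    fin_cases k <;> simp

/-- A non-unimodular extension of the Heisenberg algebra whose action on the quotient by the centre
has the eigenvalue `tr d` is `A_{4,9}^{-1/2}`. -/
theorem IsMilnorFrame.nonempty_lieEquiv_A49 (h : IsMilnorFrame e a d) (h0 : a 0 ≠ 0)
    (h1 : a 1 = 0) (h2 : a 2 = 0) (ht : d 0 0 + d 1 1 + d 2 2 ≠ 0) {x : Fin 3 → ℝ}
    (hx : x 1 ≠ 0 ∨ x 2 ≠ 0)
    (hx₁ : d 1 1 * x 1 + d 1 2 * x 2 = (d 0 0 + d 1 1 + d 2 2) * x 1)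
    (hx₂ : d 2 1 * x 1 + d 2 2 * x 2 = (d 0 0 + d 1 1 + d 2 2) * x 2) :
    Nonempty (g ≃ₗ⁅ℝ⁆ A49 (-1 / 2)) := by
  obtain ⟨⟨j0, -, -⟩, k0, -, k2⟩ := h.derivation
  have j0' := (mul_eq_zero.1 j0).resolve_left h0
  have d10 : d 1 0 = 0 := by simpa [h1, h0] using k0
  have d20 : d 2 0 = 0 := by simpa [h2, h0] using k2
  set t := d 0 0 + d 1 1 + d 2 2 with htdef
  obtain ⟨e', h'⟩ := h.exists_shift ![0, d 0 2 / a 0, -(d 0 1 / a 0)] (inv_ne_zero ht)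
  have d00 : t⁻¹ * d 0 0 = 1 / 2 := by
    field_simp
    linarith
  -- `d / t - 1` has the kernel `x` on the quotient, so it is `y ↦ ⟨x^⊥, y⟩ u`, and `u` is the
  -- other eigenvector.
  have hu : ∀ m m' : ℝ, m * x 1 + m' * x 2 = 0 → ∃ u, m = -(u * x 2) ∧ m' = u * x 1 := by
    intro m m' hm
    rcases hx with hx | hx
    · refine ⟨m' / x 1, ?_, by field_simp⟩
      field_simp
      linarith
    · refine ⟨-m / x 2, by field_simp, ?_⟩
      field_simp
      linarith
  obtain ⟨u₁, hu1, hu1'⟩ := hu (t⁻¹ * d 1 1 - 1) (t⁻¹ * d 1 2) (by field_simp; linarith)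
  obtain ⟨u₂, hu2, hu2'⟩ := hu (t⁻¹ * d 2 1) (t⁻¹ * d 2 2 - 1) (by field_simp; linarith)
  have htr : t⁻¹ * d 1 1 + t⁻¹ * d 2 2 = 1 / 2 := by
    field_simp
    linarith
  have hdet : x 1 * u₂ - x 2 * u₁ = -3 / 2 := by linarith
  have d11 : t⁻¹ * d 1 1 = 1 - u₁ * x 2 := by linarith
  have d22 : t⁻¹ * d 2 2 = 1 + u₂ * x 1 := by linarith
  obtain ⟨F, hF⟩ := exists_basis_of_injective e'
    ![(3 / 2 * a 0) • e' 0, x 1 • e' 1 + x 2 • e' 2, u₁ • e' 1 + u₂ • e' 2, e' 3] fun c hc => by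
      have q0 := congrArg (fun x => e'.repr x 0) hc
      have q1 := congrArg (fun x => e'.repr x 1) hc
      have q2 := congrArg (fun x => e'.repr x 2) hc
      have q3 := congrArg (fun x => e'.repr x 3) hc
      simp [h0] at q0 q1 q2 q3
      refine ⟨q0, ?_, ?_, q3⟩ <;> refine (mul_eq_zero.1 (?_ : _ * (-3 / 2 : ℝ) = 0)).resolve_right
        (by norm_num) <;> rw [← hdet]
      · linear_combination u₂ * q1 - u₁ * q2
      · linear_combination x 1 * q2 - x 2 * q1
  have l0 := h'.lie_three_zero
  have l1 := h'.lie_three_one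
  have l2 := h'.lie_three_two
  have r10 : ⁅e' 1, e' 0⁆ = 0 := by rw [← lie_skew, h'.lie_zero_one, h2, zero_smul, neg_zero]
  have r20 : ⁅e' 2, e' 0⁆ = 0 := by rw [h'.lie_two_zero, h1, zero_smul]
  have r21 : ⁅e' 2, e' 1⁆ = -(a 0 • e' 0) := by rw [← lie_skew, h'.lie_one_two]
  simp [h0, h1, h2, d10, d20, d00, hu1', hu2, d11, d22] at l0 l1 l2
  refine HalfFlat.nonempty_lieEquiv_A49 F ?_ ?_ ?_ ?_ ?_ ?_
  · simp [hF, r10, r20]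
  · simp [hF, r10, r20]
  · simp only [hF, Matrix.cons_val, add_lie, lie_add, lie_smul, smul_lie, lie_self, r21,
      h'.lie_one_two]
    refine e'.ext_elem fun k => ?_
    fin_cases k <;> simp
    linear_combination -(a 0) * hdet
  · simp [hF, l0]
    module
  · simp [hF, l1, l2]
    module
  · simp only [hF, Matrix.cons_val, lie_add, lie_smul, l1, l2]
    refine e'.ext_elem fun k => ?_
    fin_cases k <;> simp
    · linear_combination u₁ * hdet
    · linear_combination u₂ * hdet

/-- A non-unimodular extension of the Lie algebra of rigid motions of the Euclidean or the
Lorentzian plane is `A_{4,12}` or `𝔯₂ ⊕ 𝔯₂`, and the latter is decomposable. -/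
theorem IsMilnorFrame.nonempty_lieEquiv_A412 (h : IsMilnorFrame e a d) (hg : IsIndecomposable g)
    (h0 : a 0 ≠ 0) (h1 : a 1 ≠ 0) (h2 : a 2 = 0) (ht : d 0 0 + d 1 1 + d 2 2 ≠ 0) :
    Nonempty (g ≃ₗ⁅ℝ⁆ A412) := by
  obtain ⟨⟨j0, j1, -⟩, k0, k1, k2⟩ := h.derivation
  have j0' := (mul_eq_zero.1 j0).resolve_left h0
  have j1' := (mul_eq_zero.1 j1).resolve_left h1
  have d20 : d 2 0 = 0 := by simpa [h2, h0] using k2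
  have d21 : d 2 1 = 0 := by simpa [h2, h1] using k1
  have d22 : d 2 2 = 0 := by linarith
  have d11 : d 1 1 = d 0 0 := by linarith
  have d00 : d 0 0 ≠ 0 := by
    intro h3
    rw [d11, d22, h3] at ht
    simp at ht
  have d01 : d 0 1 + d 1 0 / a 1 * a 0 = 0 := by
    field_simp
    linarith
  obtain ⟨e', h'⟩ := h.exists_shift ![-(d 1 2 / a 1), d 0 2 / a 0, d 1 0 / a 1] (inv_ne_zero d00)
  have l0 := h'.lie_three_zero
  have l1 := h'.lie_three_one
  have l2 := h'.lie_three_two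
  simp [h0, h1, h2, d20, d21, d22, d11, d00, d01] at l0 l1 l2
  have r01 : ⁅e' 0, e' 1⁆ = 0 := by rw [h'.lie_zero_one, h2, zero_smul]
  have r10 : ⁅e' 1, e' 0⁆ = 0 := by rw [← lie_skew, r01, neg_zero]
  have r20 := h'.lie_two_zero
  have r21 : ⁅e' 2, e' 1⁆ = -(a 0 • e' 0) := by rw [← lie_skew, h'.lie_one_two]
  have r02 : ⁅e' 0, e' 2⁆ = -(a 1 • e' 1) := by rw [← lie_skew, h'.lie_two_zero]
  have r12 := h'.lie_one_two
  have m0 : ⁅e' 0, e' 3⁆ = -e' 0 := by rw [← lie_skew, l0]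
  have m1 : ⁅e' 1, e' 3⁆ = -e' 1 := by rw [← lie_skew, l1]
  have m2 : ⁅e' 2, e' 3⁆ = 0 := by rw [← lie_skew, l2, neg_zero]
  rcases lt_or_gt_of_ne (mul_ne_zero h0 h1) with hneg | hpos
  · exfalso
    set k := √(-(a 0 * a 1)) with hk
    have hk0 : k ≠ 0 := (Real.sqrt_pos.2 (by linarith)).ne'
    have hk2 : k * k = -(a 0 * a 1) := Real.mul_self_sqrt (by linarith)
    -- The half of `1 + q` for the involution `q` in the centroid with `q (k e₃) = e₂`.
    let p : g →ₗ[ℝ] g := e'.constr ℝ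
      ![(1 / 2 : ℝ) • e' 0 + (a 1 / (2 * k)) • e' 1, (1 / 2 : ℝ) • e' 1 + (k / (2 * a 1)) • e' 0,
        (1 / 2 : ℝ) • e' 2 + (k / 2) • e' 3, (1 / 2 : ℝ) • e' 3 + (1 / (2 * k)) • e' 2]
    have p0 : p (e' 0) = (1 / 2 : ℝ) • e' 0 + (a 1 / (2 * k)) • e' 1 := e'.constr_basis ℝ _ 0
    have p1 : p (e' 1) = (1 / 2 : ℝ) • e' 1 + (k / (2 * a 1)) • e' 0 := e'.constr_basis ℝ _ 1
    have p2 : p (e' 2) = (1 / 2 : ℝ) • e' 2 + (k / 2) • e' 3 := e'.constr_basis ℝ _ 2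
    have p3 : p (e' 3) = (1 / 2 : ℝ) • e' 3 + (1 / (2 * k)) • e' 2 := e'.constr_basis ℝ _ 3
    have hlie := centroid_of_basis e' p fun i j => by
      refine e'.ext_elem fun l => ?_
      fin_cases i <;> fin_cases j <;>
        simp [p0, p1, p2, p3, r01, r10, r20, r21, r02, r12, l0, l1, l2, m0, m1, m2] <;>
        fin_cases l <;> simp <;> field_simp <;> linarith
    have hp : p ∘ₗ p = p := e'.ext fun i => by
      refine e'.ext_elem fun l => ?_
      fin_cases i <;> simp [p0, p1, p2, p3] <;>
        fin_cases l <;> simp <;> field_simp <;> norm_num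
    rcases hg.idempotent_eq p hlie (fun x => LinearMap.congr_fun hp x) with h3 | h3 <;>
    · have h4 := congrArg (fun x => e'.repr x 0) p0
      simp [h3] at h4
      try norm_num at h4
  · set k := √(a 0 * a 1) with hk
    have hk0 : k ≠ 0 := (Real.sqrt_pos.2 hpos).ne'
    have hk2 : k * k = a 0 * a 1 := Real.mul_self_sqrt hpos.le
    obtain ⟨F, hF⟩ := exists_basis_of_injective e'
      ![e' 0, (a 1 / k) • e' 1, e' 3, (-1 / k) • e' 2] fun c hc => by
        have q0 := congrArg (fun x => e'.repr x 0) hc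
        have q1 := congrArg (fun x => e'.repr x 1) hc
        have q2 := congrArg (fun x => e'.repr x 2) hc
        have q3 := congrArg (fun x => e'.repr x 3) hc
        simp [h1, hk0] at q0 q1 q2 q3
        exact ⟨q0, q1, q3, q2⟩
    refine HalfFlat.nonempty_lieEquiv_A412 F ?_ ?_ ?_ ?_ ?_ ?_
    · simp [hF, r10]
    · simp [hF, l0]
    · simp [hF, l1]
    · simp [hF, r20]
      module
    · simp only [hF, Matrix.cons_val, lie_smul, smul_lie, r21]
      refine e'.ext_elem fun l => ?_
      fin_cases l <;> simp
      field_simp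
      linarith
    · simp [hF, m2]

theorem lie_coordBasis_r2 :
    ⁅coordBasis r2Bracket 0, coordBasis r2Bracket 1⁆ = (-1 : ℝ) • coordBasis r2Bracket 1 := by
  have hb : ∀ (x y : r2) (k : Fin 2), ⁅x, y⁆ k = -![0, coordWedge 0 1 x y] k := fun _ _ _ => rfl
  have hs : ∀ (c : ℝ) (x : r2) (k : Fin 2), (c • x) k = c * x k := fun _ _ _ => rfl
  have hc := coordBasis_apply r2Bracket
  funext k
  fin_cases k <;> simp [hb, hs, hc, coordWedge]

/-- As `tr d ≠ 0`, the obstruction is the determinant of the two-forms `x`, `y`, `τ`, where `y` lies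
in `[n, n]`. This excludes the abelian ideal `n`, and for the Heisenberg algebra it makes `x` an
eigenvector of `d` on `n / [n, n]` for the eigenvalue `tr d`. -/
theorem IsMilnorFrame.not_admits_r2 (h : IsMilnorFrame e a d) (hg : IsIndecomposable g)
    (ha₁ : a 0 = 0 → a 1 = 0) (ha₂ : a 1 = 0 → a 2 = 0) (ht : d 0 0 + d 1 1 + d 2 2 ≠ 0)
    (h49 : ¬ Nonempty (g ≃ₗ⁅ℝ⁆ A49 (-1 / 2))) (h412 : ¬ Nonempty (g ≃ₗ⁅ℝ⁆ A412)) :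
    ¬ AdmitsHalfFlatSU3 (g × r2) := by
  intro hadm
  obtain ⟨C⟩ := exists_closedCoords h lie_coordBasis_r2 hadm
  have hc : C.c = 0 := (mul_eq_zero.1 C.trace_c).resolve_left ht
  have hs : C.s = 0 := (mul_eq_zero.1 C.trace_s).resolve_left ht
  have hs' : C.s' = 0 := (mul_eq_zero.1 C.trace_s').resolve_left ht
  have hnd := C.nondegenerate
  rw [hc, hs, hs'] at hnd
  have hy : ∀ k, a k = 0 → C.y k = 0 := fun k hk => by
    simpa [hk] using (C.closed_γ k).symm
  by_cases h0 : a 0 = 0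
  · have h1 := ha₁ h0
    exact hnd (by rw [hy 0 h0, hy 1 h1, hy 2 (ha₂ h1)]; ring)
  by_cases h1 : a 1 = 0
  · have h2 := ha₂ h1
    have hx1 := C.closed_x 1
    have hx2 := C.closed_x 2
    obtain ⟨-, k0, -, k2⟩ := h.derivation
    have d10 : d 1 0 = 0 := by simpa [h1, h0] using k0
    have d20 : d 2 0 = 0 := by simpa [h2, h0] using k2
    simp only [h1, h2, d10, d20] at hx1 hx2
    refine h49 (h.nonempty_lieEquiv_A49 h0 h1 h2 ht (x := C.x) ?_ (by linarith) (by linarith))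
    by_contra! hx
    exact hnd (by rw [hy 1 h1, hy 2 h2, hx.1, hx.2]; ring)
  by_cases h2 : a 2 = 0
  · exact h412 (h.nonempty_lieEquiv_A412 hg h0 h1 h2 ht)
  · obtain ⟨⟨j0, j1, j2⟩, -⟩ := h.derivation
    have j0' := (mul_eq_zero.1 j0).resolve_left h0
    have j1' := (mul_eq_zero.1 j1).resolve_left h1
    have j2' := (mul_eq_zero.1 j2).resolve_left h2
    exact ht (by linarith)

end NonAbelian

/-! ### Milnor frames of four-dimensional Lie algebras -/

section Existence

variable {g : Type*} [LieRing g] [LieAlgebra ℝ g]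

theorem trace_ad_eq_sum (e : Module.Basis (Fin 4) ℝ g) (x : g) :
    LinearMap.trace ℝ g (LieAlgebra.ad ℝ g x) =
      e.repr ⁅x, e 0⁆ 0 + e.repr ⁅x, e 1⁆ 1 + e.repr ⁅x, e 2⁆ 2 + e.repr ⁅x, e 3⁆ 3 := by
  rw [LinearMap.trace_eq_matrix_trace ℝ e, Matrix.trace, Fin.sum_univ_four]
  simp [LinearMap.toMatrix_apply]

theorem eq_zero_of_sq_add_sq_add_sq {x y z : ℝ} (h : x ^ 2 + y ^ 2 + z ^ 2 = 0) :
    x = 0 ∧ y = 0 ∧ z = 0 := by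
  refine ⟨?_, ?_, ?_⟩ <;> refine pow_eq_zero_iff two_ne_zero |>.1 ?_ <;>
    linarith [sq_nonneg x, sq_nonneg y, sq_nonneg z]

/-- A four-dimensional unimodular Lie algebra is not perfect: the exact two-forms `dα` satisfy
`dα ∧ dα = d(α ∧ dα) = 0` by unimodularity, but an isotropic subspace of `Λ²ℝ⁴`, with the wedge
product of signature `(3, 3)`, has at most dimension three. -/
theorem exists_closed_of_isUnimodular (hdim : Module.finrank ℝ g = 4) (hg : IsUnimodular g) :
    ∃ f : g →ₗ[ℝ] ℝ, f ≠ 0 ∧ ∀ x y : g, f ⁅x, y⁆ = 0 := by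
  have hfin : FiniteDimensional ℝ g := Module.finite_of_finrank_pos (by omega)
  let e : Module.Basis (Fin 4) ℝ g := Module.finBasisOfFinrankEq ℝ g hdim
  let E : Fin 4 → Fin 4 → (g →ₗ[ℝ] ℝ) →ₗ[ℝ] ℝ := fun i j => LinearMap.applyₗ ⁅e i, e j⁆
  have hE : ∀ i j f, E i j f = f ⁅e i, e j⁆ := fun _ _ _ => rfl
  -- The self-dual part of `df`.
  let P : (g →ₗ[ℝ] ℝ) →ₗ[ℝ] (Fin 3 → ℝ) :=
    LinearMap.pi ![E 0 1 + E 2 3, E 0 2 - E 1 3, E 0 3 + E 1 2]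
  have hker : LinearMap.ker P ≠ ⊥ := LinearMap.ker_ne_bot_of_finrank_lt (by
    rw [Module.finrank_fin_fun, Module.finrank_linearMap, hdim, Module.finrank_self]
    norm_num)
  obtain ⟨f, hfP, hf0⟩ := (Submodule.ne_bot_iff _).1 hker
  have hP := LinearMap.mem_ker.1 hfP
  have p0 : f ⁅e 0, e 1⁆ + f ⁅e 2, e 3⁆ = 0 := congrFun hP 0
  have p1 : f ⁅e 0, e 2⁆ - f ⁅e 1, e 3⁆ = 0 := congrFun hP 1
  have p2 : f ⁅e 0, e 3⁆ + f ⁅e 1, e 2⁆ = 0 := congrFun hP 2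
  have expand : ∀ x y : g, f ⁅x, y⁆ = e.repr x 0 * f ⁅e 0, y⁆ + e.repr x 1 * f ⁅e 1, y⁆ +
      e.repr x 2 * f ⁅e 2, y⁆ + e.repr x 3 * f ⁅e 3, y⁆ := fun x y => by
    have h := e.sum_repr x
    rw [Fin.sum_univ_four] at h
    conv_lhs => rw [← h]
    simp
  have hF : ∀ x : g, f x = e.repr x 0 * f (e 0) + e.repr x 1 * f (e 1) +
      e.repr x 2 * f (e 2) + e.repr x 3 * f (e 3) := fun x => by
    have h := e.sum_repr x
    rw [Fin.sum_univ_four] at h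
    conv_lhs => rw [← h]
    simp
  have hjac : ∀ i j k,
      (e.repr ⁅e i, e j⁆ 0 * f ⁅e 0, e k⁆ + e.repr ⁅e i, e j⁆ 1 * f ⁅e 1, e k⁆ +
        e.repr ⁅e i, e j⁆ 2 * f ⁅e 2, e k⁆ + e.repr ⁅e i, e j⁆ 3 * f ⁅e 3, e k⁆) +
      (e.repr ⁅e j, e k⁆ 0 * f ⁅e 0, e i⁆ + e.repr ⁅e j, e k⁆ 1 * f ⁅e 1, e i⁆ +
        e.repr ⁅e j, e k⁆ 2 * f ⁅e 2, e i⁆ + e.repr ⁅e j, e k⁆ 3 * f ⁅e 3, e i⁆) -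
      (e.repr ⁅e i, e k⁆ 0 * f ⁅e 0, e j⁆ + e.repr ⁅e i, e k⁆ 1 * f ⁅e 1, e j⁆ +
        e.repr ⁅e i, e k⁆ 2 * f ⁅e 2, e j⁆ + e.repr ⁅e i, e k⁆ 3 * f ⁅e 3, e j⁆) = 0 := by
    intro i j k
    rw [← expand, ← expand, ← expand]
    have h1 := congrArg f (leibniz_lie (e i) (e j) (e k))
    have s1 : ⁅e i, ⁅e j, e k⁆⁆ = -⁅⁅e j, e k⁆, e i⁆ := (lie_skew _ _).symm
    have s2 : ⁅e j, ⁅e i, e k⁆⁆ = -⁅⁅e i, e k⁆, e j⁆ := (lie_skew _ _).symm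
    rw [s1, s2, map_add, map_neg, map_neg] at h1
    linarith
  have hskew : ∀ i j, j < i → ⁅e i, e j⁆ = -⁅e j, e i⁆ := fun i j _ => (lie_skew _ _).symm
  have T := fun k => trace_ad_eq_sum e (e k)
  simp only [hg (e _)] at T
  have J012 := hjac 0 1 2
  have J013 := hjac 0 1 3
  have J023 := hjac 0 2 3
  have J123 := hjac 1 2 3
  have T0 := T 0
  have T1 := T 1
  have T2 := T 2
  have T3 := T 3
  have F01 := hF ⁅e 0, e 1⁆
  have F02 := hF ⁅e 0, e 2⁆
  have F03 := hF ⁅e 0, e 3⁆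
  have F12 := hF ⁅e 1, e 2⁆
  have F13 := hF ⁅e 1, e 3⁆
  have F23 := hF ⁅e 2, e 3⁆
  simp [hskew, -lie_skew] at J012 J013 J023 J123 T0 T1 T2 T3
  -- `df ∧ df` is `d(f ∧ df)`, a combination of the Jacobi identities and of the traces.
  have hQ : f ⁅e 0, e 1⁆ * f ⁅e 2, e 3⁆ - f ⁅e 0, e 2⁆ * f ⁅e 1, e 3⁆
      + f ⁅e 0, e 3⁆ * f ⁅e 1, e 2⁆ = 0 := by
    generalize f ⁅e 0, e 1⁆ = A01, f ⁅e 0, e 2⁆ = A02, f ⁅e 0, e 3⁆ = A03,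
      f ⁅e 1, e 2⁆ = A12, f ⁅e 1, e 3⁆ = A13, f ⁅e 2, e 3⁆ = A23 at *
    linear_combination (1 / 2) * (A23 * F01 + A01 * F23 - A13 * F02 - A02 * F13 + A12 * F03
      + A03 * F12 - f (e 3) * J012 + f (e 2) * J013 - f (e 1) * J023 + f (e 0) * J123
      - (f (e 1) * A23 - f (e 2) * A13 + f (e 3) * A12) * T0
      + (f (e 0) * A23 - f (e 2) * A03 + f (e 3) * A02) * T1
      - (f (e 0) * A13 - f (e 1) * A03 + f (e 3) * A01) * T2
      + (f (e 0) * A12 - f (e 1) * A02 + f (e 2) * A01) * T3)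
  have hsq : f ⁅e 0, e 1⁆ ^ 2 + f ⁅e 0, e 2⁆ ^ 2 + f ⁅e 0, e 3⁆ ^ 2 = 0 := by
    linear_combination -hQ + f ⁅e 0, e 1⁆ * p0 + f ⁅e 0, e 2⁆ * p1 + f ⁅e 0, e 3⁆ * p2
  clear hjac expand hF J012 J013 J023 J123 T0 T1 T2 T3 F01 F02 F03 F12 F13 F23
  obtain ⟨z01, z02, z03⟩ := eq_zero_of_sq_add_sq_add_sq hsq
  have z23 : f ⁅e 2, e 3⁆ = 0 := by linear_combination p0 - z01
  have z13 : f ⁅e 1, e 3⁆ = 0 := by linear_combination z02 - p1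
  have z12 : f ⁅e 1, e 2⁆ = 0 := by linear_combination p2 - z03
  refine ⟨f, hf0, closed_of_basis e f fun i j hij => ?_⟩
  rw [hskew i j hij, map_neg, neg_eq_zero]
  fin_cases i <;> fin_cases j <;> simp at hij ⊢ <;> assumption

/-- There is a closed one-form on whose kernel `tr ad` vanishes: `tr ad` itself, unless it is
zero. -/
theorem exists_closed_trace (hdim : Module.finrank ℝ g = 4) :
    ∃ f : g →ₗ[ℝ] ℝ, f ≠ 0 ∧ (∀ x y : g, f ⁅x, y⁆ = 0) ∧
      ∀ x, f x = 0 → LinearMap.trace ℝ g (LieAlgebra.ad ℝ g x) = 0 := by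
  by_cases hg : IsUnimodular g
  · obtain ⟨f, h0, h1⟩ := exists_closed_of_isUnimodular hdim hg
    exact ⟨f, h0, h1, fun x _ => hg x⟩
  · let f : g →ₗ[ℝ] ℝ :=
      { toFun := fun x => LinearMap.trace ℝ g (LieAlgebra.ad ℝ g x)
        map_add' := fun x y => by rw [map_add, map_add]
        map_smul' := fun t x => by rw [map_smul, map_smul, RingHom.id_apply] }
    refine ⟨f, fun h0 => hg fun x => LinearMap.congr_fun h0 x, fun x y => ?_, fun x hx => hx⟩
    change LinearMap.trace ℝ g (LieAlgebra.ad ℝ g ⁅x, y⁆) = 0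
    have h : LieAlgebra.ad ℝ g ⁅x, y⁆ = LieAlgebra.ad ℝ g x * LieAlgebra.ad ℝ g y -
        LieAlgebra.ad ℝ g y * LieAlgebra.ad ℝ g x := LinearMap.ext fun z => lie_lie x y z
    rw [h, map_sub, LinearMap.trace_mul_comm, sub_self]

/-- A basis adapted to the kernel of a non-zero linear form. -/
theorem exists_basis_of_linearForm (hdim : Module.finrank ℝ g = 4) (f : g →ₗ[ℝ] ℝ) (hf : f ≠ 0) :
    ∃ v : Module.Basis (Fin 4) ℝ g, f (v 0) = 0 ∧ f (v 1) = 0 ∧ f (v 2) = 0 ∧ f (v 3) = 1 := by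
  have hfin : FiniteDimensional ℝ g := Module.finite_of_finrank_pos (by omega)
  obtain ⟨z₀, hz₀⟩ : ∃ z, f z ≠ 0 := by
    by_contra! h
    exact hf (LinearMap.ext h)
  obtain ⟨z, hz⟩ : ∃ z, f z = 1 := ⟨(f z₀)⁻¹ • z₀, by simp [hz₀]⟩
  have hker : Module.finrank ℝ (LinearMap.ker f) = 3 := by
    have := Module.Dual.finrank_ker_add_one_of_ne_zero (f := f) hf
    omega
  let k : Module.Basis (Fin 3) ℝ (LinearMap.ker f) := Module.finBasisOfFinrankEq ℝ _ hker
  have hk : ∀ i, f (k i) = 0 := fun i => LinearMap.mem_ker.1 (k i).2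
  obtain ⟨v, hv⟩ := exists_basis_of_injective (Module.finBasisOfFinrankEq ℝ g hdim)
    ![(k 0 : g), k 1, k 2, z] fun c hc => by
      simp only [Matrix.cons_val] at hc
      have h3 : c 3 = 0 := by
        have := congrArg f hc
        simpa [hk, hz] using this
      rw [h3, zero_smul, add_zero] at hc
      have h := Fintype.linearIndependent_iff.1 k.linearIndependent ![c 0, c 1, c 2] (by
        rw [Fin.sum_univ_three]
        exact Subtype.ext hc)
      exact ⟨h 0, h 1, h 2, h3⟩
  exact ⟨v, by simp [hv, hk], by simp [hv, hk], by simp [hv, hk], by simp [hv, hz]⟩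

/-- An orthonormal basis of eigenvectors of a symmetric `3 × 3` matrix. -/
theorem exists_orthonormal_eigenvectors (S : Matrix (Fin 3) (Fin 3) ℝ) (hS : S.IsHermitian) :
    ∃ (v : Fin 3 → Fin 3 → ℝ) (l : Fin 3 → ℝ),
      (∀ i j, S j 0 * v i 0 + S j 1 * v i 1 + S j 2 * v i 2 = l i * v i j) ∧
      (∀ j k, v 0 j * v 0 k + v 1 j * v 1 k + v 2 j * v 2 k = if j = k then 1 else 0) ∧
      (∀ i j, v i 0 * v j 0 + v i 1 * v j 1 + v i 2 * v j 2 = if i = j then 1 else 0) := by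
  refine ⟨fun i j => hS.eigenvectorBasis i j, hS.eigenvalues, fun i j => ?_, fun j k => ?_,
    fun i j => ?_⟩
  · have h := congrFun (hS.mulVec_eigenvectorBasis i) j
    simpa [Matrix.mulVec, dotProduct, Fin.sum_univ_three] using h
  · have h := congrFun (congrFun (Matrix.mem_unitaryGroup_iff.1 hS.eigenvectorUnitary.2) j) k
    rw [Matrix.mul_apply, Matrix.one_apply] at h
    simpa [Matrix.mul_apply, Fin.sum_univ_three, Matrix.one_apply] using h
  · have h := congrFun (congrFun (Matrix.mem_unitaryGroup_iff'.1 hS.eigenvectorUnitary.2) i) j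
    rw [Matrix.mul_apply, Matrix.one_apply] at h
    simpa [Matrix.mul_apply, Fin.sum_univ_three, Matrix.one_apply] using h

/-- The cyclic permutation of the first three vectors. -/
theorem IsMilnorFrame.rotate {e : Module.Basis (Fin 4) ℝ g} {a : Fin 3 → ℝ}
    {d : Fin 3 → Fin 3 → ℝ} (h : IsMilnorFrame e a d) :
    ∃ e' : Module.Basis (Fin 4) ℝ g,
      IsMilnorFrame e' (fun i => a (i + 1)) (fun i j => d (i + 1) (j + 1)) := by
  let e' : Module.Basis (Fin 4) ℝ g :=
    e.reindex ⟨![2, 0, 1, 3], ![1, 2, 0, 3], by decide, by decide⟩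
  have h0 : e' 0 = e 1 := e.reindex_apply _ _
  have h1 : e' 1 = e 2 := e.reindex_apply _ _
  have h2 : e' 2 = e 0 := e.reindex_apply _ _
  have h3 : e' 3 = e 3 := e.reindex_apply _ _
  refine ⟨e', ?_, ?_, ?_, ?_, ?_, ?_⟩
  · rw [h0, h1, h2]; exact h.lie_two_zero
  · rw [h0, h1, h2]; exact h.lie_zero_one
  · rw [h0, h1, h2]; exact h.lie_one_two
  · rw [h0, h1, h2, h3, h.lie_three_one, add_assoc, add_comm]; rfl
  · rw [h0, h1, h2, h3, h.lie_three_two, add_assoc, add_comm]; rfl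
  · rw [h0, h1, h2, h3, h.lie_three_zero, add_assoc, add_comm]; rfl

/-- The non-zero structure constants of the ideal can be moved to the front. -/
theorem IsMilnorFrame.exists_sorted {e : Module.Basis (Fin 4) ℝ g} {a : Fin 3 → ℝ}
    {d : Fin 3 → Fin 3 → ℝ} (h : IsMilnorFrame e a d) :
    ∃ (e' : Module.Basis (Fin 4) ℝ g) (a' : Fin 3 → ℝ) (d' : Fin 3 → Fin 3 → ℝ),
      IsMilnorFrame e' a' d' ∧ (a' 0 = 0 → a' 1 = 0) ∧ (a' 1 = 0 → a' 2 = 0) ∧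
      d' 0 0 + d' 1 1 + d' 2 2 = d 0 0 + d 1 1 + d 2 2 := by
  obtain ⟨e₁, h₁⟩ := h.rotate
  obtain ⟨e₂, h₂⟩ := h₁.rotate
  by_cases H : (a 0 = 0 → a 1 = 0) ∧ (a 1 = 0 → a 2 = 0)
  · exact ⟨e, a, d, h, H.1, H.2, rfl⟩
  by_cases H₁ : (a 1 = 0 → a 2 = 0) ∧ (a 2 = 0 → a 0 = 0)
  · exact ⟨e₁, _, _, h₁, H₁.1, H₁.2, by change d 1 1 + d 2 2 + d 0 0 = _; ring⟩
  · refine ⟨e₂, _, _, h₂, ?_, ?_, by change d 2 2 + d 0 0 + d 1 1 = _; ring⟩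
    · change a 2 = 0 → a 0 = 0
      tauto
    · change a 0 = 0 → a 1 = 0
      tauto

/-- The cross products of the vectors of an orthonormal basis of `ℝ³`. -/
theorem exists_cross_eq {v : Fin 3 → Fin 3 → ℝ}
    (hv : ∀ j k, v 0 j * v 0 k + v 1 j * v 1 k + v 2 j * v 2 k = if j = k then 1 else 0) :
    ∃ μ : ℝ, ∀ i : Fin 3,
      v (i + 1) 1 * v (i + 2) 2 - v (i + 1) 2 * v (i + 2) 1 = μ * v i 0 ∧
      v (i + 1) 2 * v (i + 2) 0 - v (i + 1) 0 * v (i + 2) 2 = μ * v i 1 ∧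
      v (i + 1) 0 * v (i + 2) 1 - v (i + 1) 1 * v (i + 2) 0 = μ * v i 2 := by
  have h00 := hv 0 0
  have h01 := hv 0 1
  have h02 := hv 0 2
  have h11 := hv 1 1
  have h12 := hv 1 2
  have h22 := hv 2 2
  simp at h00 h01 h02 h11 h12 h22
  refine ⟨v 0 0 * (v 1 1 * v 2 2 - v 1 2 * v 2 1) + v 0 1 * (v 1 2 * v 2 0 - v 1 0 * v 2 2)
    + v 0 2 * (v 1 0 * v 2 1 - v 1 1 * v 2 0), fun i => ?_⟩
  fin_cases i
  · change v 1 1 * v 2 2 - v 1 2 * v 2 1 = _ * v 0 0 ∧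
      v 1 2 * v 2 0 - v 1 0 * v 2 2 = _ * v 0 1 ∧ v 1 0 * v 2 1 - v 1 1 * v 2 0 = _ * v 0 2
    refine ⟨?_, ?_, ?_⟩
    · linear_combination -(v 1 1 * v 2 2 - v 1 2 * v 2 1) * h00
        - (v 1 2 * v 2 0 - v 1 0 * v 2 2) * h01 - (v 1 0 * v 2 1 - v 1 1 * v 2 0) * h02
    · linear_combination -(v 1 1 * v 2 2 - v 1 2 * v 2 1) * h01
        - (v 1 2 * v 2 0 - v 1 0 * v 2 2) * h11 - (v 1 0 * v 2 1 - v 1 1 * v 2 0) * h12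
    · linear_combination -(v 1 1 * v 2 2 - v 1 2 * v 2 1) * h02
        - (v 1 2 * v 2 0 - v 1 0 * v 2 2) * h12 - (v 1 0 * v 2 1 - v 1 1 * v 2 0) * h22
  · change v 2 1 * v 0 2 - v 2 2 * v 0 1 = _ * v 1 0 ∧
      v 2 2 * v 0 0 - v 2 0 * v 0 2 = _ * v 1 1 ∧ v 2 0 * v 0 1 - v 2 1 * v 0 0 = _ * v 1 2
    refine ⟨?_, ?_, ?_⟩
    · linear_combination -(v 2 1 * v 0 2 - v 2 2 * v 0 1) * h00
        - (v 2 2 * v 0 0 - v 2 0 * v 0 2) * h01 - (v 2 0 * v 0 1 - v 2 1 * v 0 0) * h02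
    · linear_combination -(v 2 1 * v 0 2 - v 2 2 * v 0 1) * h01
        - (v 2 2 * v 0 0 - v 2 0 * v 0 2) * h11 - (v 2 0 * v 0 1 - v 2 1 * v 0 0) * h12
    · linear_combination -(v 2 1 * v 0 2 - v 2 2 * v 0 1) * h02
        - (v 2 2 * v 0 0 - v 2 0 * v 0 2) * h12 - (v 2 0 * v 0 1 - v 2 1 * v 0 0) * h22
  · change v 0 1 * v 1 2 - v 0 2 * v 1 1 = _ * v 2 0 ∧
      v 0 2 * v 1 0 - v 0 0 * v 1 2 = _ * v 2 1 ∧ v 0 0 * v 1 1 - v 0 1 * v 1 0 = _ * v 2 2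
    refine ⟨?_, ?_, ?_⟩
    · linear_combination -(v 0 1 * v 1 2 - v 0 2 * v 1 1) * h00
        - (v 0 2 * v 1 0 - v 0 0 * v 1 2) * h01 - (v 0 0 * v 1 1 - v 0 1 * v 1 0) * h02
    · linear_combination -(v 0 1 * v 1 2 - v 0 2 * v 1 1) * h01
        - (v 0 2 * v 1 0 - v 0 0 * v 1 2) * h11 - (v 0 0 * v 1 1 - v 0 1 * v 1 0) * h12
    · linear_combination -(v 0 1 * v 1 2 - v 0 2 * v 1 1) * h02
        - (v 0 2 * v 1 0 - v 0 0 * v 1 2) * h12 - (v 0 0 * v 1 1 - v 0 1 * v 1 0) * h22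

end Existence

section Existence

variable {g : Type*} [LieRing g] [LieAlgebra ℝ g]

theorem lie_combination (x : Fin 4 → g) (p q : Fin 3 → ℝ) :
    ⁅p 0 • x 0 + p 1 • x 1 + p 2 • x 2, q 0 • x 0 + q 1 • x 1 + q 2 • x 2⁆ =
      (p 1 * q 2 - p 2 * q 1) • ⁅x 1, x 2⁆ + (p 2 * q 0 - p 0 * q 2) • ⁅x 2, x 0⁆ +
        (p 0 * q 1 - p 1 * q 0) • ⁅x 0, x 1⁆ := by
  have h10 : ⁅x 1, x 0⁆ = -⁅x 0, x 1⁆ := (lie_skew _ _).symm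
  have h21 : ⁅x 2, x 1⁆ = -⁅x 1, x 2⁆ := (lie_skew _ _).symm
  have h02 : ⁅x 0, x 2⁆ = -⁅x 2, x 0⁆ := (lie_skew _ _).symm
  simp only [lie_add, add_lie, lie_smul, smul_lie, lie_self, h10, h21, h02]
  module

/-- Every four-dimensional Lie algebra has a Milnor frame. The ideal is the kernel of the closed
form of `exists_closed_trace`; being unimodular, it has a bracket `Λ²n → n` that becomes symmetric
under an identification `Λ²n = n`, and an orthonormal basis of eigenvectors diagonalizes it. -/
theorem exists_milnorFrame (hdim : Module.finrank ℝ g = 4) :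
    ∃ (e : Module.Basis (Fin 4) ℝ g) (a : Fin 3 → ℝ) (d : Fin 3 → Fin 3 → ℝ),
      IsMilnorFrame e a d ∧ (a 0 = 0 → a 1 = 0) ∧ (a 1 = 0 → a 2 = 0) ∧
      (d 0 0 + d 1 1 + d 2 2 = 0 → IsUnimodular g) := by
  suffices H : ∃ (e : Module.Basis (Fin 4) ℝ g) (a : Fin 3 → ℝ) (d : Fin 3 → Fin 3 → ℝ),
      IsMilnorFrame e a d ∧ (d 0 0 + d 1 1 + d 2 2 = 0 → IsUnimodular g) by
    obtain ⟨e, a, d, h, hu⟩ := H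
    obtain ⟨e', a', d', h', h₁, h₂, ht⟩ := h.exists_sorted
    exact ⟨e', a', d', h', h₁, h₂, fun h0 => hu (ht ▸ h0)⟩
  obtain ⟨f, hf0, hf, htr⟩ := exists_closed_trace hdim
  obtain ⟨x, x0, x1, x2, x3⟩ := exists_basis_of_linearForm hdim f hf0
  have hr : ∀ w, x.repr w 3 = f w := fun w => by
    have h := congrArg f (x.sum_repr w)
    rw [Fin.sum_univ_four] at h
    simpa [-Module.Basis.sum_repr, x0, x1, x2, x3] using h
  have expand : ∀ w z : g, ⁅w, z⁆ =
      x.repr ⁅w, z⁆ 0 • x 0 + x.repr ⁅w, z⁆ 1 • x 1 + x.repr ⁅w, z⁆ 2 • x 2 := fun w z => by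
    conv_lhs => rw [← x.sum_repr ⁅w, z⁆]
    rw [Fin.sum_univ_four, hr, hf, zero_smul, add_zero]
  obtain ⟨S, b12, b20, b01⟩ : ∃ S : Matrix (Fin 3) (Fin 3) ℝ,
      ⁅x 1, x 2⁆ = S 0 0 • x 0 + S 0 1 • x 1 + S 0 2 • x 2 ∧
      ⁅x 2, x 0⁆ = S 1 0 • x 0 + S 1 1 • x 1 + S 1 2 • x 2 ∧
      ⁅x 0, x 1⁆ = S 2 0 • x 0 + S 2 1 • x 1 + S 2 2 • x 2 :=
    ⟨fun i j => x.repr (![⁅x 1, x 2⁆, ⁅x 2, x 0⁆, ⁅x 0, x 1⁆] i) j.castSucc,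
      expand _ _, expand _ _, expand _ _⟩
  have b10 : ⁅x 1, x 0⁆ = -⁅x 0, x 1⁆ := (lie_skew _ _).symm
  have b21 : ⁅x 2, x 1⁆ = -⁅x 1, x 2⁆ := (lie_skew _ _).symm
  have b02 : ⁅x 0, x 2⁆ = -⁅x 2, x 0⁆ := (lie_skew _ _).symm
  -- The trace of `ad` on the kernel of `f` is the skew part of `S`.
  have T0 := trace_ad_eq_sum x (x 0)
  have T1 := trace_ad_eq_sum x (x 1)
  have T2 := trace_ad_eq_sum x (x 2)
  rw [htr _ x0, hr, hf, b02, b01, b20, lie_self] at T0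
  rw [htr _ x1, hr, hf, b10, b01, b12, lie_self] at T1
  rw [htr _ x2, hr, hf, b21, b12, b20, lie_self] at T2
  simp at T0 T1 T2
  have hS : S.IsHermitian := by
    ext i j
    rw [Matrix.conjTranspose_apply, star_trivial]
    fin_cases i <;> fin_cases j <;> simp <;> linarith
  obtain ⟨v, l, hv, hv₁, hv₂⟩ := exists_orthonormal_eigenvectors S hS
  obtain ⟨μ, hμ⟩ := exists_cross_eq hv₁
  have hbr : ∀ i, ⁅v (i + 1) 0 • x 0 + v (i + 1) 1 • x 1 + v (i + 1) 2 • x 2,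
      v (i + 2) 0 • x 0 + v (i + 2) 1 • x 1 + v (i + 2) 2 • x 2⁆ =
      (μ * l i) • (v i 0 • x 0 + v i 1 • x 1 + v i 2 • x 2) := fun i => by
    rw [lie_combination, (hμ i).1, (hμ i).2.1, (hμ i).2.2, b12, b20, b01]
    match_scalars
    · linear_combination μ * hv i 0 - μ * v i 1 * T2 + μ * v i 2 * T1
    · linear_combination μ * hv i 1 - μ * v i 2 * T0 + μ * v i 0 * T2
    · linear_combination μ * hv i 2 - μ * v i 0 * T1 + μ * v i 1 * T0
  obtain ⟨e, he⟩ := exists_basis_of_injective x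
    ![v 0 0 • x 0 + v 0 1 • x 1 + v 0 2 • x 2, v 1 0 • x 0 + v 1 1 • x 1 + v 1 2 • x 2,
      v 2 0 • x 0 + v 2 1 • x 1 + v 2 2 • x 2, x 3] fun c hc => by
      have h0 := congrArg (fun w => x.repr w 0) hc
      have h1 := congrArg (fun w => x.repr w 1) hc
      have h2 := congrArg (fun w => x.repr w 2) hc
      have h3 := congrArg (fun w => x.repr w 3) hc
      simp at h0 h1 h2 h3
      have h00 := hv₂ 0 0
      have h01 := hv₂ 0 1
      have h02 := hv₂ 0 2
      have h11 := hv₂ 1 1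
      have h12 := hv₂ 1 2
      have h22 := hv₂ 2 2
      simp at h00 h01 h02 h11 h12 h22
      refine ⟨?_, ?_, ?_, h3⟩
      · linear_combination v 0 0 * h0 + v 0 1 * h1 + v 0 2 * h2 - c 0 * h00 - c 1 * h01 - c 2 * h02
      · linear_combination v 1 0 * h0 + v 1 1 * h1 + v 1 2 * h2 - c 0 * h01 - c 1 * h11 - c 2 * h12
      · linear_combination v 2 0 * h0 + v 2 1 * h1 + v 2 2 * h2 - c 0 * h02 - c 1 * h12 - c 2 * h22
  have e0 : e 0 = v 0 0 • x 0 + v 0 1 • x 1 + v 0 2 • x 2 := congrFun he 0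
  have e1 : e 1 = v 1 0 • x 0 + v 1 1 • x 1 + v 1 2 • x 2 := congrFun he 1
  have e2 : e 2 = v 2 0 • x 0 + v 2 1 • x 1 + v 2 2 • x 2 := congrFun he 2
  have e3 : e 3 = x 3 := congrFun he 3
  have f0 : f (e 0) = 0 := by simp [e0, x0, x1, x2]
  have f1 : f (e 1) = 0 := by simp [e1, x0, x1, x2]
  have f2 : f (e 2) = 0 := by simp [e2, x0, x1, x2]
  have f3 : f (e 3) = 1 := by rw [e3, x3]
  have hr' : ∀ w, e.repr w 3 = f w := fun w => by
    have h := congrArg f (e.sum_repr w)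
    rw [Fin.sum_univ_four] at h
    simpa [-Module.Basis.sum_repr, f0, f1, f2, f3] using h
  have expand' : ∀ w z : g, ⁅w, z⁆ =
      e.repr ⁅w, z⁆ 0 • e 0 + e.repr ⁅w, z⁆ 1 • e 1 + e.repr ⁅w, z⁆ 2 • e 2 := fun w z => by
    conv_lhs => rw [← e.sum_repr ⁅w, z⁆]
    rw [Fin.sum_univ_four, hr', hf, zero_smul, add_zero]
  refine ⟨e, fun i => μ * l i, fun j i => e.repr ⁅e 3, e i.castSucc⁆ j.castSucc,
    ⟨?_, ?_, ?_, expand' _ _, expand' _ _, expand' _ _⟩, fun ht w => ?_⟩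
  · rw [e0, e1, e2]
    exact hbr 0
  · rw [e0, e1, e2]
    exact hbr 1
  · rw [e0, e1, e2]
    exact hbr 2
  · have h3 : LinearMap.trace ℝ g (LieAlgebra.ad ℝ g (e 3)) = 0 := by
      rw [trace_ad_eq_sum e, hr', hf, add_zero]
      exact ht
    have hw : f (w - f w • e 3) = 0 := by simp [f3]
    have h := htr _ hw
    rw [map_sub, map_sub, map_smul, map_smul, h3, smul_zero, sub_zero] at h
    exact h

end Existence

/-! ### The sum of `A_{4,5}^{-1/2,-1/2}` with `𝔯₂` -/

section Exceptional

set_option maxHeartbeats 800000 in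
/-- The brackets are those of `A_{4,5}^{-1/2,-1/2} ⊕ 𝔯₂`: the commuting vectors `b 4` and `b 5` act
diagonally on the abelian ideal spanned by the other four. With `c`, `γ`, `τ` as in `ClosedCoords`
and `D = diag(1, -1/2, -1/2)`, the metric on the span of the covectors dual to `b 4` and `b 5` has the
entries `-c ⟨τ, D² γ⟩` and `c ⟨τ, γ⟩` on the diagonal, up to a common factor, and its symmetry means
`c ⟨τ, D γ⟩ = 0`; this is impossible if the diagonal entries are to have the same sign. -/
theorem not_admitsHalfFlatSU3_of_brackets {h : Type*} [LieRing h] [LieAlgebra ℝ h]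
    (b : Module.Basis (Fin 6) ℝ h)
    (l50 : ⁅b 5, b 0⁆ = b 0) (l51 : ⁅b 5, b 1⁆ = (-1 / 2 : ℝ) • b 1)
    (l52 : ⁅b 5, b 2⁆ = (-1 / 2 : ℝ) • b 2) (l43 : ⁅b 4, b 3⁆ = -b 3)
    (l01 : ⁅b 0, b 1⁆ = 0) (l02 : ⁅b 0, b 2⁆ = 0) (l12 : ⁅b 1, b 2⁆ = 0) (l03 : ⁅b 0, b 3⁆ = 0)
    (l13 : ⁅b 1, b 3⁆ = 0) (l23 : ⁅b 2, b 3⁆ = 0) (l53 : ⁅b 5, b 3⁆ = 0) (l40 : ⁅b 4, b 0⁆ = 0)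
    (l41 : ⁅b 4, b 1⁆ = 0) (l42 : ⁅b 4, b 2⁆ = 0) (l45 : ⁅b 4, b 5⁆ = 0) :
    ¬ AdmitsHalfFlatSU3 h := by
  rintro ⟨hL, ν, hν, ω, ρ, hs, hρ, hσ⟩
  obtain ⟨hpos, hsymm⟩ := hs.contractedForm_pair b
  have hσ' : ∃ σ : Form (h) 4, IsClosedForm (k := 3) σ ∧
      ∀ v : Fin 5 → h, pfaffianVector ω v =
        ev4 σ (v 1) (v 2) (v 3) (v 4) • v 0 + (-ev4 σ (v 0) (v 2) (v 3) (v 4)) • v 1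
          + ev4 σ (v 0) (v 1) (v 3) (v 4) • v 2 + (-ev4 σ (v 0) (v 1) (v 2) (v 4)) • v 3
          + ev4 σ (v 0) (v 1) (v 2) (v 3) • v 4 :=
    by
    refine ⟨wedge (p := 2) (q := 2) ω ω, ?_, ?_⟩
    · exact hσ
    · exact fun _ => rfl
  obtain ⟨σ, hσ', hP⟩ := hσ'
  have hu5 : skip b 5 = ![b 0, b 1, b 2, b 3, b 4] := by
    funext k
    fin_cases k <;> rfl
  have hu4 : skip b 4 = ![b 0, b 1, b 2, b 3, b 5] := by
    funext k
    fin_cases k <;> rfl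
  rw [hu4, hu5] at hpos hsymm
  simp only [contractedForm_apply (hP _)] at hpos hsymm
  have e3 (i j k : Fin 6) (_ : j < i) : ev3 ρ (b i) (b j) (b k) = -ev3 ρ (b j) (b i) (b k) :=
    ev3_swap _ _ _ _
  have e3' (i j k : Fin 6) (_ : k < j) : ev3 ρ (b i) (b j) (b k) = -ev3 ρ (b i) (b k) (b j) :=
    ev3_swap' _ _ _ _
  have z3 (x y : h) : ev3 ρ x x y = 0 := by linarith [ev3_swap ρ x x y]
  have z3' (x y : h) : ev3 ρ x y y = 0 := by linarith [ev3_swap' ρ x y y]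
  have e4 (i j k l : Fin 6) (_ : j < i) :
      ev4 σ (b i) (b j) (b k) (b l) = -ev4 σ (b j) (b i) (b k) (b l) := ev4_swap _ _ _ _ _
  have e4' (i j k l : Fin 6) (_ : k < j) :
      ev4 σ (b i) (b j) (b k) (b l) = -ev4 σ (b i) (b k) (b j) (b l) := ev4_swap' _ _ _ _ _
  have e4'' (i j k l : Fin 6) (_ : l < k) :
      ev4 σ (b i) (b j) (b k) (b l) = -ev4 σ (b i) (b j) (b l) (b k) := ev4_swap'' _ _ _ _ _
  have x0 := hρ.ev3 (b 5) (b 1) (b 2) (b 3)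
  have x1 := hρ.ev3 (b 5) (b 0) (b 2) (b 3)
  have x2 := hρ.ev3 (b 5) (b 0) (b 1) (b 3)
  have y0 := hρ.ev3 (b 4) (b 5) (b 1) (b 2)
  have y1 := hρ.ev3 (b 4) (b 5) (b 0) (b 2)
  have y2 := hρ.ev3 (b 4) (b 5) (b 0) (b 1)
  have c0 := hρ.ev3 (b 4) (b 5) (b 0) (b 3)
  have c1 := hρ.ev3 (b 4) (b 5) (b 1) (b 3)
  have c2 := hρ.ev3 (b 4) (b 5) (b 2) (b 3)
  have s := hσ'.ev4 (b 4) (b 0) (b 1) (b 2) (b 3)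
  have t0 := hσ'.ev4 (b 4) (b 5) (b 1) (b 2) (b 3)
  have t1 := hσ'.ev4 (b 4) (b 5) (b 0) (b 2) (b 3)
  have t2 := hσ'.ev4 (b 4) (b 5) (b 0) (b 1) (b 3)
  simp only [l50, l51, l52, l43, l01, l02, l12, l03, l13, l23, l53, l40, l41, l42, l45]
    at x0 x1 x2 y0 y1 y2 c0 c1 c2 s t0 t1 t2
  simp [ev3_smul, ev3_neg, ev3_zero, e3, e3'] at x0 x1 x2 y0 y1 y2 c0 c1 c2
  simp [ev4_smul, ev4_neg, ev4_zero, e4, e4', e4''] at s t0 t1 t2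
  simp [ev3_add, ev3_smul, ev3_neg, e3, e3', z3, z3'] at hpos hsymm
  replace x1 : ev3 ρ (b 0) (b 2) (b 3) = 0 := by linear_combination -2 * x1
  replace x2 : ev3 ρ (b 0) (b 1) (b 3) = 0 := by linear_combination -2 * x2
  replace y1 : ev3 ρ (b 0) (b 2) (b 4) = 0 := by linear_combination 2 * y1
  replace y2 : ev3 ρ (b 0) (b 1) (b 4) = 0 := by linear_combination 2 * y2
  replace c0 : ev3 ρ (b 0) (b 3) (b 5) = -ev3 ρ (b 0) (b 3) (b 4) := by linear_combination c0
  replace c1 : ev3 ρ (b 1) (b 3) (b 5) = 1 / 2 * ev3 ρ (b 1) (b 3) (b 4) := by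
    linear_combination c1
  replace c2 : ev3 ρ (b 2) (b 3) (b 5) = 1 / 2 * ev3 ρ (b 2) (b 3) (b 4) := by
    linear_combination c2
  replace t0 : ev4 σ (b 1) (b 2) (b 3) (b 5) = ev4 σ (b 1) (b 2) (b 3) (b 4) := by
    linear_combination -t0
  replace t1 : ev4 σ (b 0) (b 2) (b 3) (b 5) = -1 / 2 * ev4 σ (b 0) (b 2) (b 3) (b 4) := by
    linear_combination -t1
  replace t2 : ev4 σ (b 0) (b 1) (b 3) (b 5) = -1 / 2 * ev4 σ (b 0) (b 1) (b 3) (b 4) := by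
    linear_combination -t2
  simp only [x0, x1, x2, y0, y1, y2, c0, c1, c2, s, t0, t1, t2] at hpos hsymm
  -- The contributions of `b 0` and of `b 1`, `b 2` to `c ⟨τ, γ⟩`.
  obtain ⟨U, hU⟩ : ∃ U, U = ev3 ρ (b 0) (b 1) (b 2) *
    (ev4 σ (b 1) (b 2) (b 3) (b 4) * ev3 ρ (b 0) (b 3) (b 4)) := ⟨_, rfl⟩
  obtain ⟨W, hW⟩ : ∃ W, W = ev3 ρ (b 0) (b 1) (b 2) *
    (ev4 σ (b 0) (b 1) (b 3) (b 4) * ev3 ρ (b 2) (b 3) (b 4) -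
      ev4 σ (b 0) (b 2) (b 3) (b 4) * ev3 ρ (b 1) (b 3) (b 4)) := ⟨_, rfl⟩
  have hUW : W = 2 * U := by
    linear_combination -(1 / 2) * hsymm + hW - 2 * hU
  have hneg : 0 < (-2 * U - 1 / 2 * W) * (2 * U + 2 * W) := by
    refine hpos.trans_eq ?_
    rw [hU, hW]
    ring
  rw [hUW] at hneg
  nlinarith [sq_nonneg U]

theorem lie_coordBasis_A45 {α β : ℝ} :
    (⁅coordBasis (A45Bracket α β) 3, coordBasis (A45Bracket α β) 0⁆ =
        coordBasis (A45Bracket α β) 0 ∧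
      ⁅coordBasis (A45Bracket α β) 3, coordBasis (A45Bracket α β) 1⁆ =
        α • coordBasis (A45Bracket α β) 1 ∧
      ⁅coordBasis (A45Bracket α β) 3, coordBasis (A45Bracket α β) 2⁆ =
        β • coordBasis (A45Bracket α β) 2) ∧
    ⁅coordBasis (A45Bracket α β) 0, coordBasis (A45Bracket α β) 1⁆ = 0 ∧
    ⁅coordBasis (A45Bracket α β) 0, coordBasis (A45Bracket α β) 2⁆ = 0 ∧
    ⁅coordBasis (A45Bracket α β) 1, coordBasis (A45Bracket α β) 2⁆ = 0 := by
  have hb : ∀ (x y : A45 α β) (k : Fin 4), ⁅x, y⁆ k = -![coordWedge 0 3 x y,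
    α * coordWedge 1 3 x y, β * coordWedge 2 3 x y, 0] k := fun _ _ _ => rfl
  have hs : ∀ (c : ℝ) (x : A45 α β) (k : Fin 4), (c • x) k = c * x k := fun _ _ _ => rfl
  have h0 : ∀ (k : Fin 4), (0 : A45 α β) k = 0 := fun _ => rfl
  have hc := coordBasis_apply (A45Bracket α β)
  refine ⟨⟨?_, ?_, ?_⟩, ?_, ?_, ?_⟩ <;> funext k <;> rw [hb] <;> fin_cases k <;>
    simp [hs, h0, hc, coordWedge]

theorem not_admits_A45_r2 : ¬ AdmitsHalfFlatSU3 (A45 (-1 / 2) (-1 / 2) × r2) := by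
  obtain ⟨⟨l30, l31, l32⟩, l01, l02, l12⟩ := lie_coordBasis_A45 (α := -1 / 2) (β := -1 / 2)
  have hr := lie_coordBasis_r2
  have hb := prodBasis_eq (coordBasis (A45Bracket (-1 / 2) (-1 / 2)))
    ((coordBasis r2Bracket).reindex (Equiv.swap 0 1))
  have k0 : ((coordBasis r2Bracket).reindex (Equiv.swap 0 1)) 0 = coordBasis r2Bracket 1 := by simp
  have k1 : ((coordBasis r2Bracket).reindex (Equiv.swap 0 1)) 1 = coordBasis r2Bracket 0 := by simp
  rw [k0, k1] at hb
  rw [neg_one_smul] at hr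
  exact not_admitsHalfFlatSU3_of_brackets
    (prodBasis (coordBasis (A45Bracket (-1 / 2) (-1 / 2)))
      ((coordBasis r2Bracket).reindex (Equiv.swap 0 1)))
    (by simp [hb, l30]) (by simp [hb, l31]) (by simp [hb, l32]) (by simp [hb, hr])
    (by simp [hb, l01]) (by simp [hb, l02]) (by simp [hb, l12]) (by simp [hb]) (by simp [hb])
    (by simp [hb]) (by simp [hb]) (by simp [hb]) (by simp [hb]) (by simp [hb]) (by simp [hb])

end Exceptional

end HalfFlat

end

theorem proposition3p3 :
    (∀ (g : Type*) [LieRing g] [LieAlgebra ℝ g],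
      Module.finrank ℝ g = 4 → HalfFlat.IsIndecomposable g →
        ¬ HalfFlat.AdmitsHalfFlatSU3 (g × HalfFlat.R2)) ∧
    (∀ (g : Type*) [LieRing g] [LieAlgebra ℝ g],
      Module.finrank ℝ g = 4 → HalfFlat.IsIndecomposable g →
      ¬ HalfFlat.IsUnimodular g →
      ¬ Nonempty (g ≃ₗ⁅ℝ⁆ HalfFlat.A49 (-1 / 2)) →
      ¬ Nonempty (g ≃ₗ⁅ℝ⁆ HalfFlat.A412) →
        ¬ HalfFlat.AdmitsHalfFlatSU3 (g × HalfFlat.r2)) ∧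
    ¬ HalfFlat.AdmitsHalfFlatSU3 (HalfFlat.A45 (-1 / 2) (-1 / 2) × HalfFlat.r2) := by
  refine ⟨fun g _ _ hdim hg => ?_, fun g _ _ hdim hg hu h49 h412 => ?_,
    HalfFlat.not_admits_A45_r2⟩
  · obtain ⟨e, a, d, h, h₁, h₂, -⟩ := HalfFlat.exists_milnorFrame hdim
    exact h.not_admits_R2 hg h₁ h₂
  · obtain ⟨e, a, d, h, h₁, h₂, hd⟩ := HalfFlat.exists_milnorFrame hdim
    exact h.not_admits_r2 hg h₁ h₂ (fun ht => hu (hd ht)) h49 h412
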